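/- **Conventions.** Let $\mathbb T=\mathbb R\cup\{-\infty\}$ with $x\oplus y=\max(x,y)$, $x\otimes y=x+y$, $x\oslash y=x-y$, $1_{\mathbb T}=0$, $x^{\otimes a}=ax$, and $\mathbb{TP}^m=\mathbb R^{m+1}/\mathbb R(1,\dots,1)$. Let $\sigma$ be the surface measure on the unit sphere $S^{n-1}\subset\mathbb R^n$ and $\omega_n=\sigma(S^{n-1})=2\pi^{n/2}/\Gamma(n/2)$. A tropical entire function on $\mathbb R^n$ is a function $g:\mathbb R^n\to\mathbb R$ of the form $g(x)=\max_{i\ge 0}\,(a_i+\langle \mathbf m_i,x\rangle)$ with $a_i\in\mathbb T$, $\mathbf m_i\in\mathbb R^n$, where on every ball finitely many terms suffice to attain the maximum. For a continuous piecewise linear $g$ put $J_g(x;\varphi)=\partial^+_\varphi g(x)+\partial^+_{-\varphi}g(x)$, with $\partial_\varphi^+g(x)=\lim_{h\to0^+}(g(x+h\varphi)-g(x))/h$. A point $x$ is smooth if $J_g(x;\varphi)=0$ for all unit vectors $\varphi$, a pole if $J_g(x;\varphi)<0$ for some unit vector $\varphi$, and a root otherwise. With $g_\theta(s)=g(s\theta)$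 for $s\in\mathbb R$, the counting function is $$N(r,g)=\frac12\int_0^r\frac1{\omega_n}\int_{S^{n-1}}\ \sum_{|s|<t,\ J_{g_\theta}(s;1)<0}|J_{g_\theta}(s;1)|\,d\sigma(\theta)\,dt ,$$ and $N(r,1_{\mathbb T}\oslash g)=N(r,-g)$ counts the roots of $g$. A tropical holomorphic map $f=[f_0:\dots:f_m]:\mathbb R^n\to\mathbb{TP}^m$ is a map with a reduced representation, that is, with tropical entire functions $f_0,\dots,f_m$ that have no root common to all of them. Its characteristic function is $T_f(r)=\frac1{\omega_n}\int_{S^{n-1}}\max_i f_i(r\theta)\,d\sigma(\theta)-\max_i f_i(0)$. A homogeneous tropical polynomial of degree $\delta$ is $P(x)=\bigoplus_{|I|=\delta}c_I\otimes x^{\otimes I}=\max_{|I|=\delta}(c_I+\sum_i I_ix_i)$, $I\in\mathbb Z_{\ge0}^{m+1}$, $c_I\in\mathbb T$ not all $-\infty$. The hypersurface $V_P\subset\mathbb{TP}^m$ is the set of points where the maximum is attained by at least two monomials, and $P\circ f=P(f_0,\dots,f_m)$. The map $f$ is tropical algebraically nondegenerate if $f(\mathbb R^n)\not\subset V_P$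 for every homogeneous tropical polynomial $P$ of every degree $\delta\ge1$. For $P$ of degree $\delta$, let $\hat\ell(P\circ f)$ be the least number $k$ such that $P\circ f=\bigoplus_{i=1}^k a_i\otimes f^{I_i}$ with $a_i\in\mathbb R$ and distinct exponents $I_i$, $|I_i|=\delta$, where $f^{I}=f_0^{\otimes I_0}\otimes\cdots\otimes f_m^{\otimes I_m}$; $P\circ f$ is complete if $\hat\ell(P\circ f)=\binom{m+\delta}{\delta}$. For $c\in\mathbb R^n\setminus\{0\}$ the tropical Casorati determinant is $C_o(g_0,\dots,g_M)(x)=\max_{\pi}\sum_{j=0}^M g_j(x+\pi(j)c)$, over all permutations $\pi$ of $\{0,\dots,M\}$. **Theorem (Second Main Theorem for tropical hypersurfaces).** Let $n,m\ge 1$, and let $f:\mathbb R^n\to\mathbb{TP}^m$ be a tropical algebraically nondegenerate tropical holomorphic map with $\limsup_{r\to\infty}\frac{\log T_f(r)}{r}=0$. Let $P_1,\dots,P_q$ be homogeneous tropical polynomials in $m+1$ variables of degrees $d_1,\dots,d_q\ge1$, let $d=\operatorname{lcm}(d_1,\dots,d_q)$ and $M=\binom{m+d}{d}-1$, and assume $q\ge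 M+1$. Let $\lambda=ddg(\{P_{M+2}\circ f,\dots,P_q\circ f\})$ be the number of indices $j\in\{M+2,\dots,q\}$ for which $P_j\circ f$ is not complete. Let $c\in\mathbb R^n\setminus\{0\}$. Then, as $r\to\infty$ outside a measurable set $E$ of zero upper density, i.e. $\limsup_{r\to\infty}\frac1r|E\cap[1,r]|=0$, $$\begin{aligned}(q-M-1-\lambda)\,T_f(r)&\le\sum_{j=1}^q\frac1{d_j}N\big(r,1_{\mathbb T}\oslash (P_j\circ f)\big)-\frac1dN\Big(r,1_{\mathbb T}\oslash C_o\big(P_1^{\otimes d/d_1}\circ f,\dots,P_{M+1}^{\otimes d/d_{M+1}}\circ f\big)\Big)+o(T_f(r))\\&\le\sum_{j=M+2}^q\frac1{d_j}N\big(r,1_{\mathbb T}\oslash (P_j\circ f)\big)+o(T_f(r))\\&\le(q-M-1)\,T_f(r)+o(T_f(r)).\end{aligned}$$ -/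

import Mathlib

open MeasureTheory Filter Topology Asymptotics

namespace TropicalNevanlinna

/-- The Euclidean space `ℝⁿ`. -/
abbrev Euc (n : ℕ) : Type := EuclideanSpace ℝ (Fin n)

/-! ### One-sided directional derivatives, roots and poles -/

/-- The `φ`-positive directional derivative `lim_{h → 0⁺} (g (x + h φ) - g x) / h`. -/
noncomputable def posDirDeriv {E : Type*} [NormedAddCommGroup E] [NormedSpace ℝ E]
    (g : E → ℝ) (x φ : E) : ℝ :=
  derivWithin (fun h : ℝ => g (x + h • φ)) (Set.Ioi 0) 0

/-- `J_g(x; φ) = ∂⁺_φ g(x) + ∂⁺_{-φ} g(x)`. -/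
noncomputable def J {E : Type*} [NormedAddCommGroup E] [NormedSpace ℝ E]
    (g : E → ℝ) (x φ : E) : ℝ :=
  posDirDeriv g x φ + posDirDeriv g x (-φ)

/-- `x` is a smooth point of `g`. -/
def IsSmoothPoint {n : ℕ} (g : Euc n → ℝ) (x : Euc n) : Prop :=
  ∀ φ : Euc n, ‖φ‖ = 1 → J g x φ = 0

/-- `x` is a tropical pole of `g`. -/
def IsTropicalPole {n : ℕ} (g : Euc n → ℝ) (x : Euc n) : Prop :=
  ∃ φ : Euc n, ‖φ‖ = 1 ∧ J g x φ < 0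

/-- `x` is a tropical root of `g`: neither a smooth point nor a pole. -/
def IsTropicalRoot {n : ℕ} (g : Euc n → ℝ) (x : Euc n) : Prop :=
  ¬ IsSmoothPoint g x ∧ ¬ IsTropicalPole g x

/-! ### Tropical entire functions -/

/-- A (not identically `-∞`) tropical entire function on `ℝⁿ`:
`g x = max_i (a i + ⟨v i, x⟩)` with coefficients `a i ∈ ℝ ∪ {-∞}` and real exponent vectors `v i`,
the maximum being attained, on every ball, by the terms from a finite index set (so that `g` is a
continuous piecewise linear function with locally finitely many linear pieces). -/
def IsTropicalEntire {n : ℕ} (g : Euc n → ℝ) : Prop :=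
  ∃ (a : ℕ → WithBot ℝ) (v : ℕ → Euc n),
    (∀ i x, a i + ((inner ℝ (v i) x : ℝ) : WithBot ℝ) ≤ (g x : WithBot ℝ)) ∧
    ∀ R : ℝ, ∃ s : Finset ℕ, ∀ x : Euc n, ‖x‖ ≤ R →
      ∃ i ∈ s, a i + ((inner ℝ (v i) x : ℝ) : WithBot ℝ) = (g x : WithBot ℝ)

/-! ### Spherical means and the counting function -/

/-- The surface measure `σ` on the unit sphere `S^{n-1}(1)`. -/
noncomputable def sphereMeasure (n : ℕ) : Measure (Metric.sphere (0 : Euc n) 1) :=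
  (volume : Measure (Euc n)).toSphere

/-- The surface area `ω_n` of the unit sphere `S^{n-1}(1)`. -/
noncomputable def sphereArea (n : ℕ) : ℝ := (sphereMeasure n).real Set.univ

theorem sphereArea_eq (n : ℕ) (hn : 0 < n) :
    sphereArea n = 2 * Real.pi ^ ((n : ℝ) / 2) / Real.Gamma ((n : ℝ) / 2) := by
  have : Nonempty (Fin n) := ⟨⟨0, hn⟩⟩
  have hn' : (0 : ℝ) < n := by exact_mod_cast hn
  have hG : Real.Gamma ((n : ℝ) / 2) ≠ 0 := (Real.Gamma_pos_of_pos (by positivity)).ne'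
  rw [sphereArea, sphereMeasure, Measure.toSphere_real_apply_univ, measureReal_def,
    EuclideanSpace.volume_ball, Real.Gamma_add_one (by positivity)]
  simp only [finrank_euclideanSpace, Fintype.card_fin, ENNReal.ofReal_one, one_pow, one_mul]
  rw [ENNReal.toReal_ofReal (by positivity), Real.sqrt_eq_rpow, ← Real.rpow_natCast,
    ← Real.rpow_mul Real.pi_pos.le, show (1 / 2 : ℝ) * n = n / 2 by ring]
  field_simp

/-- The spherical mean `(1 / ω_n) ∫_{S^{n-1}(1)} u θ dσ(θ)`. -/
noncomputable def sphereMean (n : ℕ) (u : Euc n → ℝ) : ℝ :=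
  (1 / sphereArea n) * ∫ θ : Metric.sphere (0 : Euc n) 1, u θ ∂(sphereMeasure n)

/-- For a function `u` of one real variable: the number `n(t, u)` of its poles in `(-t, t)`,
counted with multiplicity. -/
noncomputable def polesOnLine (t : ℝ) (u : ℝ → ℝ) : ℝ :=
  ∑ᶠ x ∈ {x : ℝ | |x| < t ∧ J u x 1 < 0}, |J u x 1|

/-- `n(t, g)`: the mean over all directions `θ` of `n(t, g_θ)`, where `g_θ s = g (s θ)`. -/
noncomputable def poleCount {n : ℕ} (t : ℝ) (g : Euc n → ℝ) : ℝ :=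
  sphereMean n (fun θ => polesOnLine t (fun s : ℝ => g (s • θ)))

/-- The counting function of poles `N(r, g) = (1 / 2) ∫₀^r n(t, g) dt`. -/
noncomputable def countingN {n : ℕ} (r : ℝ) (g : Euc n → ℝ) : ℝ :=
  (1 / 2) * ∫ t in (0 : ℝ)..r, poleCount t g

/-- The counting function of roots `N(r, 1_𝕋 ⊘ g)`, where `1_𝕋 ⊘ g = 0 - g`. -/
noncomputable def countingRoots {n : ℕ} (r : ℝ) (g : Euc n → ℝ) : ℝ :=
  countingN r (fun x => 0 - g x)

/-! ### Tropical projective space, hypersurfaces, holomorphic maps -/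

/-- The tropical projective space `𝕋ℙᵐ = ℝ^{m+1} / ℝ(1, …, 1)`. -/
abbrev TropicalProjectiveSpace (m : ℕ) : Type :=
  (Fin (m + 1) → ℝ) ⧸ Submodule.span ℝ {(fun _ => 1 : Fin (m + 1) → ℝ)}

/-- A homogeneous tropical polynomial of degree `d` in the variables `x₀, …, x_m`:
`⨁_{|I| = d} c_I ⊗ x^{⊗ I}` with `c_I ∈ ℝ ∪ {-∞}`, not all equal to `-∞`.
`support` is the set of exponents `I` with `c_I ≠ -∞`; only the values of `coeff` on it matter. -/
structure HomTropPoly (m d : ℕ) where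
  support : Finset (Fin (m + 1) → ℕ)
  support_nonempty : support.Nonempty
  homogeneous : ∀ I ∈ support, ∑ i, I i = d
  coeff : (Fin (m + 1) → ℕ) → ℝ

/-- The value `c_I ⊗ x^{⊗ I} = c_I + ∑ I_i x_i` of a monomial of `P`. -/
def HomTropPoly.term {m d : ℕ} (P : HomTropPoly m d) (I : Fin (m + 1) → ℕ)
    (x : Fin (m + 1) → ℝ) : ℝ :=
  P.coeff I + ∑ i, (I i : ℝ) * x i

/-- The value `P(x)`. -/
noncomputable def HomTropPoly.eval {m d : ℕ} (P : HomTropPoly m d)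
    (x : Fin (m + 1) → ℝ) : ℝ :=
  P.support.sup' P.support_nonempty (fun I => P.term I x)

/-- The composition `P ∘ f`, for a representation `F = (f₀, …, f_m)` of `f`. -/
noncomputable def HomTropPoly.comp {m d n : ℕ} (P : HomTropPoly m d)
    (F : Fin (m + 1) → Euc n → ℝ) (x : Euc n) : ℝ :=
  P.eval (fun i => F i x)

/-- The tropical hypersurface `V_P ⊆ 𝕋ℙᵐ`: the points at which the maximum in `P` is attained by
at least two monomials (the condition does not depend on the representative `x`). -/
def HomTropPoly.hypersurface {m d : ℕ} (P : HomTropPoly m d) :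
    Set (TropicalProjectiveSpace m) :=
  {p | ∃ x : Fin (m + 1) → ℝ, Submodule.Quotient.mk x = p ∧
    ∃ I ∈ P.support, ∃ K ∈ P.support, I ≠ K ∧ P.term I x = P.eval x ∧ P.term K x = P.eval x}

/-- `F = (f₀, …, f_m)` is a reduced representation of `f = [f₀ : … : f_m] : ℝⁿ → 𝕋ℙᵐ`: the `f_i`
are tropical entire functions without a root common to all of them. A map `f` that has such a
representation is a tropical holomorphic map. -/
structure IsReducedRepresentation {n m : ℕ} (f : Euc n → TropicalProjectiveSpace m)
    (F : Fin (m + 1) → Euc n → ℝ) : Prop where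
  represents : ∀ x, f x = Submodule.Quotient.mk (fun i => F i x)
  entire : ∀ i, IsTropicalEntire (F i)
  no_common_root : ¬ ∃ x, ∀ i, IsTropicalRoot (F i) x

/-- `f` is tropical algebraically nondegenerate: its image lies in no tropical hypersurface. -/
def IsAlgebraicallyNondegenerate {n m : ℕ} (f : Euc n → TropicalProjectiveSpace m) : Prop :=
  ∀ (d : ℕ) (P : HomTropPoly m d), 0 < d → ¬ Set.range f ⊆ P.hypersurface

/-- `‖f(x)‖ = max {f₀(x), …, f_m(x)}`. -/
noncomputable def maxNorm {n m : ℕ} (F : Fin (m + 1) → Euc n → ℝ) (x : Euc n) : ℝ :=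
  Finset.univ.sup' Finset.univ_nonempty (fun i => F i x)

/-- Tropical Cartan characteristic function
`T_f(r) = (1 / ω_n) ∫_{S^{n-1}(1)} ‖f(r θ)‖ dσ(θ) - ‖f(0)‖`. -/
noncomputable def cartanT {n m : ℕ} (F : Fin (m + 1) → Euc n → ℝ) (r : ℝ) : ℝ :=
  sphereMean n (fun θ => maxNorm F (r • θ)) - maxNorm F 0

/-- Subnormal growth: `limsup_{r → ∞} log T(r) / r = 0`, the upper limit taken in `[-∞, ∞]`. -/
def SubnormalGrowth (T : ℝ → ℝ) : Prop :=
  limsup (fun r : ℝ => ((Real.log (T r) / r : ℝ) : EReal)) atTop = 0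

/-! ### Degeneracy and the Casorati determinant -/

/-- The shortest length of a representation of `G` as a tropical linear combination, with real
coefficients, of monomials `f^I = f₀^{⊗ i₀} ⊗ ⋯ ⊗ f_m^{⊗ i_m}` of degree `|I| = d`. -/
noncomputable def algLength {n m : ℕ} (F : Fin (m + 1) → Euc n → ℝ) (d : ℕ)
    (G : Euc n → ℝ) : ℕ :=
  sInf {k | ∃ P : HomTropPoly m d, P.support.card = k ∧ ∀ x, P.comp F x = G x}

/-- The degree of degeneracy `ddg` of the family `(P_j ∘ f)_{j ∈ s}`: the number of `j ∈ s` such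
that `P_j ∘ f` is not complete, that is, such that its shortest length is less than the number
`(m + d_j).choose d_j` of all monomials of degree `d_j`. -/
noncomputable def ddg {n m q : ℕ} (F : Fin (m + 1) → Euc n → ℝ) {deg : Fin q → ℕ}
    (P : ∀ j, HomTropPoly m (deg j)) (s : Finset (Fin q)) : ℕ :=
  (s.filter (fun j => algLength F (deg j) ((P j).comp F) < (m + deg j).choose (deg j))).card

/-- The tropical Casorati determinant
`C_o(g₀, …, g_{k-1})(x) = max_π ∑_j g_j(x + π(j) c)`. -/
noncomputable def casorati {n k : ℕ} (c : Euc n) (g : Fin k → Euc n → ℝ) (x : Euc n) : ℝ :=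
  Finset.univ.sup' Finset.univ_nonempty
    (fun π : Equiv.Perm (Fin k) => ∑ j, g j (x + ((π j : ℕ) : ℝ) • c))

/-- The upper density `limsup_{r → ∞} (1 / r) |E ∩ [1, r]|`. -/
noncomputable def upperDensity (E : Set ℝ) : ENNReal :=
  limsup (fun r : ℝ => volume (E ∩ Set.Icc 1 r) / ENNReal.ofReal r) atTop

end TropicalNevanlinna

open TropicalNevanlinna

namespace TropicalNevanlinna

/-! Every function whose roots are counted is a locally finite maximum of affine functions, hence
convex. On a line through the origin, the symmetric second difference of such a function at 0 is a
weighted sum over its kinks. Integrating over directions gives Jensen's formula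
`IsLocMaxAffine.countingRoots_eq`: the counting function of roots of `g` equals `excess g`, its
spherical mean minus `g 0`. Since `cartanT F` is `excess (maxNorm F)`, the theorem becomes a
comparison of spherical means.

A polynomial of degree `d` satisfies `P ∘ f ≤ d‖f‖ + O(1)`, which yields the last upper bound. A
complete `P ∘ f` contains all pure powers, so the reverse estimate holds as well; each incomplete
one costs at most one `T_f`, because its counting function is nonnegative.

The Casorati term needs an analogue of the lemma on the logarithmic derivative
(`isLittleO_sphereMean_abs_shift`): a fixed translation changes `P_j ∘ f` by `o(T_f)` in the mean.
Convexity bounds the change by `1/L` times values at points displaced by `±L v`, and the means of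
those values are at most a constant times `T_f(r + s) + O(1)`. Subnormal growth gives `T_f(r + s) ≤
2 T_f(r)` outside a set of density zero, and `L` is arbitrary. Hence the Casorati determinant has
the same excess as the sum of its entries, up to `o(T_f)`. -/

/-! ### Locally finite maxima of affine functions -/

/-- On every ball, `g` is the maximum of finitely many affine functions, each of which is a
minorant of `g` on the whole space. -/
def IsLocMaxAffine {E : Type*} [NormedAddCommGroup E] [InnerProductSpace ℝ E] (g : E → ℝ) : Prop :=
  ∀ R : ℝ, ∃ s : Finset (ℝ × E), (∀ p ∈ s, ∀ x, p.1 + inner ℝ p.2 x ≤ g x) ∧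
    ∀ x, ‖x‖ ≤ R → ∃ p ∈ s, p.1 + inner ℝ p.2 x = g x

namespace IsLocMaxAffine

variable {E : Type*} [NormedAddCommGroup E] [InnerProductSpace ℝ E] {g h : E → ℝ}

/-- A piece active at `x₀` is a minorant on the whole space, so its slope is a subgradient there;
convexity is derived from this. -/
theorem exists_affine_le (hg : IsLocMaxAffine g) (x₀ : E) :
    ∃ v : E, ∀ x, g x₀ + inner ℝ v (x - x₀) ≤ g x := by
  obtain ⟨s, h1, h2⟩ := hg ‖x₀‖
  obtain ⟨p, hp, hpx⟩ := h2 x₀ le_rfl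
  refine ⟨p.2, fun x => ?_⟩
  have := h1 p hp x
  rw [inner_sub_right]
  linarith

theorem convexOn (hg : IsLocMaxAffine g) : ConvexOn ℝ Set.univ g := by
  refine ⟨convex_univ, fun x _ y _ a b ha hb hab => ?_⟩
  obtain ⟨v, hv⟩ := hg.exists_affine_le (a • x + b • y)
  have hx := mul_le_mul_of_nonneg_left (hv x) ha
  have hy := mul_le_mul_of_nonneg_left (hv y) hb
  have hz : a * inner ℝ v (x - (a • x + b • y)) + b * inner ℝ v (y - (a • x + b • y)) = 0 := by
    simp only [inner_sub_right, inner_add_right, inner_smul_right]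
    linear_combination (- (a * inner ℝ v x + b * inner ℝ v y)) * hab
  have hs : a * g (a • x + b • y) + b * g (a • x + b • y) = g (a • x + b • y) := by
    rw [← add_mul, hab, one_mul]
  simp only [smul_eq_mul]
  linarith

theorem continuous [FiniteDimensional ℝ E] (hg : IsLocMaxAffine g) : Continuous g :=
  hg.convexOn.locallyLipschitz.continuous

theorem affine (a : ℝ) (v : E) : IsLocMaxAffine (fun x => a + inner ℝ v x) := fun _ =>
  ⟨{(a, v)}, by simp, by simp⟩

theorem const (a : ℝ) : IsLocMaxAffine (fun _ : E => a) := by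
  simpa using affine a (0 : E)

theorem add (hg : IsLocMaxAffine g) (hh : IsLocMaxAffine h) :
    IsLocMaxAffine (fun x => g x + h x) := by
  classical
  intro R
  obtain ⟨s, h1, h2⟩ := hg R
  obtain ⟨t, k1, k2⟩ := hh R
  refine ⟨(s ×ˢ t).image (fun p => p.1 + p.2), ?_, fun x hx => ?_⟩
  · intro p hp x
    obtain ⟨q, hq, rfl⟩ := Finset.mem_image.1 hp
    obtain ⟨hq1, hq2⟩ := Finset.mem_product.1 hq
    have := h1 _ hq1 x
    have := k1 _ hq2 x
    simp only [Prod.fst_add, Prod.snd_add, inner_add_left]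
    linarith
  · obtain ⟨p, hp, hpx⟩ := h2 x hx
    obtain ⟨q, hq, hqx⟩ := k2 x hx
    refine ⟨p + q, Finset.mem_image.2 ⟨(p, q), Finset.mem_product.2 ⟨hp, hq⟩, rfl⟩, ?_⟩
    simp only [Prod.fst_add, Prod.snd_add, inner_add_left]
    linarith

theorem sum {ι : Type*} (s : Finset ι) {G : ι → E → ℝ} (hG : ∀ i ∈ s, IsLocMaxAffine (G i)) :
    IsLocMaxAffine (fun x => ∑ i ∈ s, G i x) := by
  classical
  induction s using Finset.induction_on with
  | empty => simpa using const (E := E) 0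
  | insert i s hi ih =>
    simp only [Finset.sum_insert hi]
    exact (hG i (Finset.mem_insert_self i s)).add
      (ih fun j hj => hG j (Finset.mem_insert_of_mem hj))

theorem const_mul (hg : IsLocMaxAffine g) {a : ℝ} (ha : 0 ≤ a) :
    IsLocMaxAffine (fun x => a * g x) := by
  classical
  intro R
  obtain ⟨s, h1, h2⟩ := hg R
  refine ⟨s.image (fun p => a • p), ?_, fun x hx => ?_⟩
  · intro p hp x
    obtain ⟨q, hq, rfl⟩ := Finset.mem_image.1 hp
    have := mul_le_mul_of_nonneg_left (h1 q hq x) ha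
    simpa [inner_smul_left, mul_add] using this
  · obtain ⟨p, hp, hpx⟩ := h2 x hx
    refine ⟨a • p, Finset.mem_image_of_mem _ hp, ?_⟩
    simp [inner_smul_left, ← hpx, mul_add]

theorem sup' {ι : Type*} {s : Finset ι} (hs : s.Nonempty) {G : ι → E → ℝ}
    (hG : ∀ i ∈ s, IsLocMaxAffine (G i)) :
    IsLocMaxAffine (fun x => s.sup' hs (fun i => G i x)) := by
  classical
  intro R
  choose! t h1 h2 using fun i hi => hG i hi R
  refine ⟨s.biUnion t, ?_, fun x hx => ?_⟩
  · intro p hp x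
    obtain ⟨i, hi, hpi⟩ := Finset.mem_biUnion.1 hp
    exact (h1 i hi p hpi x).trans (Finset.le_sup' (fun i => G i x) hi)
  · obtain ⟨i, hi, hix⟩ := Finset.exists_mem_eq_sup' hs (fun i => G i x)
    obtain ⟨p, hp, hpx⟩ := h2 i hi x hx
    exact ⟨p, Finset.mem_biUnion.2 ⟨i, hi, hp⟩, hpx.trans hix.symm⟩

theorem comp_add_right (hg : IsLocMaxAffine g) (v : E) : IsLocMaxAffine (fun x => g (x + v)) := by
  classical
  intro R
  obtain ⟨s, h1, h2⟩ := hg (R + ‖v‖)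
  refine ⟨s.image (fun p => (p.1 + inner ℝ p.2 v, p.2)), ?_, fun x hx => ?_⟩
  · intro p hp x
    obtain ⟨q, hq, rfl⟩ := Finset.mem_image.1 hp
    have := h1 q hq (x + v)
    rw [inner_add_right] at this
    dsimp only
    linarith
  · obtain ⟨p, hp, hpx⟩ := h2 (x + v) ((norm_add_le _ _).trans (by linarith))
    refine ⟨_, Finset.mem_image_of_mem _ hp, ?_⟩
    rw [inner_add_right] at hpx
    dsimp only
    linarith

theorem comp_smul_right (hg : IsLocMaxAffine g) (θ : E) :
    IsLocMaxAffine (fun s : ℝ => g (s • θ)) := by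
  classical
  intro R
  obtain ⟨s, h1, h2⟩ := hg (R * ‖θ‖)
  refine ⟨s.image (fun p => (p.1, inner ℝ p.2 θ)), ?_, fun x hx => ?_⟩
  · intro p hp x
    obtain ⟨q, hq, rfl⟩ := Finset.mem_image.1 hp
    have := h1 q hq (x • θ)
    simpa [inner_smul_right] using this
  · obtain ⟨p, hp, hpx⟩ := h2 (x • θ) (by rw [norm_smul]; gcongr)
    refine ⟨_, Finset.mem_image_of_mem _ hp, ?_⟩
    simpa [inner_smul_right] using hpx

end IsLocMaxAffine

theorem IsTropicalEntire.isLocMaxAffine {n : ℕ} {g : Euc n → ℝ} (hg : IsTropicalEntire g) :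
    IsLocMaxAffine g := by
  classical
  obtain ⟨a, v, h1, h2⟩ := hg
  intro R
  obtain ⟨s, hs⟩ := h2 R
  -- Terms with coefficient `⊥` are never active. Once they are removed, the default value in
  -- `unbotD 0` is never taken.
  refine ⟨(s.filter (fun i => a i ≠ ⊥)).image (fun i => ((a i).unbotD 0, v i)), ?_, ?_⟩
  · intro p hp x
    obtain ⟨i, hi, rfl⟩ := Finset.mem_image.1 hp
    obtain ⟨b, hb⟩ := WithBot.ne_bot_iff_exists.1 (Finset.mem_filter.1 hi).2
    have := h1 i x
    rw [← hb] at this ⊢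
    exact_mod_cast this
  · intro x hx
    obtain ⟨i, hi, hix⟩ := hs x hx
    have hne : a i ≠ ⊥ := by
      intro h0
      rw [h0, WithBot.bot_add] at hix
      exact WithBot.bot_ne_coe hix
    refine ⟨_, Finset.mem_image_of_mem _ (Finset.mem_filter.2 ⟨hi, hne⟩), ?_⟩
    obtain ⟨b, hb⟩ := WithBot.ne_bot_iff_exists.1 hne
    rw [← hb] at hix ⊢
    exact_mod_cast hix

/-! ### Kinks and Jensen's formula on the line -/

theorem posDirDeriv_one {u : ℝ → ℝ} {x c : ℝ} (h : HasDerivWithinAt u c (Set.Ioi x) x) :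
    posDirDeriv u x 1 = c := by
  have h1 : HasDerivWithinAt (fun s : ℝ => x + s • (1 : ℝ)) 1 (Set.Ioi 0) 0 := by
    simpa using ((hasDerivAt_id (0 : ℝ)).const_add x).hasDerivWithinAt
  have h2 : HasDerivWithinAt u c (Set.Ioi x) (x + (0 : ℝ) • (1 : ℝ)) := by simpa using h
  have h3 := h2.comp (0 : ℝ) h1 (fun s hs => by simpa using hs)
  rw [mul_one] at h3
  exact h3.derivWithin (uniqueDiffWithinAt_Ioi 0)

theorem posDirDeriv_neg_one {u : ℝ → ℝ} {x c : ℝ} (h : HasDerivWithinAt u c (Set.Iio x) x) :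
    posDirDeriv u x (-1) = -c := by
  have h1 : HasDerivWithinAt (fun s : ℝ => x + s • (-1 : ℝ)) (-1) (Set.Ioi 0) 0 := by
    simpa using (((hasDerivAt_id (0 : ℝ)).neg).const_add x).hasDerivWithinAt
  have h2 : HasDerivWithinAt u c (Set.Iio x) (x + (0 : ℝ) • (-1 : ℝ)) := by simpa using h
  have h3 := h2.comp (0 : ℝ) h1 (fun s hs => by simpa using hs)
  rw [mul_neg_one] at h3
  exact h3.derivWithin (uniqueDiffWithinAt_Ioi 0)

theorem J_eq_sub {u : ℝ → ℝ} {x c d : ℝ} (hc : HasDerivWithinAt u c (Set.Ioi x) x)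
    (hd : HasDerivWithinAt u d (Set.Iio x) x) : J u x 1 = c - d := by
  rw [J, posDirDeriv_one hc, posDirDeriv_neg_one hd, sub_eq_add_neg]

namespace IsLocMaxAffine

variable {u : ℝ → ℝ}

/-- One-sided derivatives of a locally finite maximum of affine functions are slopes of affine
functions that are active at the point. -/
theorem exists_slope_eq (hc : Continuous u) {s : Finset (ℝ × ℝ)} {x c : ℝ} {S : Set ℝ}
    (hS : x ∉ S) [NeBot (𝓝[S] x)] (hs : ∀ᶠ y in 𝓝 x, ∃ p ∈ s, p.1 + p.2 * y = u y)
    (hd : HasDerivWithinAt u c S x) : ∃ p ∈ s, p.1 + p.2 * x = u x ∧ p.2 = c := by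
  -- Pigeonhole: one of the finitely many pieces agrees with `u` at points of `S` accumulating at
  -- `x`. Along these points the difference quotient is constantly the slope of that piece.
  have hfr : ∃ p ∈ s, ∃ᶠ y in 𝓝[S] x, p.1 + p.2 * y = u y := by
    by_contra! hcon
    have : ∀ᶠ y in 𝓝[S] x, ∀ p ∈ s, ¬ (p.1 + p.2 * y = u y) :=
      (Finset.eventually_all s).2 fun p hp => hcon p hp
    obtain ⟨y, hy1, p, hp, hy2⟩ := (this.and (hs.filter_mono nhdsWithin_le_nhds)).exists
    exact hy1 p hp hy2
  obtain ⟨p, hp, hfr⟩ := hfr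
  have hx : p.1 + p.2 * x = u x := by
    have hcl : IsClosed {y | p.1 + p.2 * y = u y} := isClosed_eq (by fun_prop) hc
    exact hcl.mem_of_frequently_of_tendsto hfr (tendsto_id'.2 nhdsWithin_le_nhds)
  refine ⟨p, hp, hx, ?_⟩
  have ht := (hasDerivWithinAt_iff_tendsto_slope' hS).1 hd
  have hfr' : ∃ᶠ y in 𝓝[S] x, slope u x y ∈ ({p.2} : Set ℝ) := by
    refine (hfr.and_eventually self_mem_nhdsWithin).mono fun y hy => ?_
    have hyx : y - x ≠ 0 := sub_ne_zero.2 fun h => hS (h ▸ hy.2)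
    rw [Set.mem_singleton_iff, slope_def_field, ← hy.1, ← hx]
    field_simp
    ring
  exact (isClosed_singleton.mem_of_frequently_of_tendsto hfr' ht).symm

theorem exists_lines (hu : IsLocMaxAffine u) (R : ℝ) : ∃ s : Finset (ℝ × ℝ),
    ∀ x, |x| ≤ R → ∃ p ∈ s, ∃ q ∈ s, p.1 + p.2 * x = u x ∧ q.1 + q.2 * x = u x ∧ q.2 ≤ p.2 ∧
      HasDerivWithinAt u p.2 (Set.Ioi x) x ∧ HasDerivWithinAt u q.2 (Set.Iio x) x := by
  -- The margin 1 makes the finite family valid on a neighbourhood of every `x` with `|x| ≤ R`,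
  -- endpoints included.
  obtain ⟨s, h1, h2⟩ := hu (R + 1)
  refine ⟨s, fun x hx => ?_⟩
  have hnear : ∀ᶠ y in 𝓝 x, ∃ p ∈ s, p.1 + p.2 * y = u y := by
    filter_upwards [Metric.ball_mem_nhds x one_pos] with y hy
    rw [Metric.mem_ball, Real.dist_eq] at hy
    obtain ⟨p, hp, hpy⟩ := h2 y (by
      rw [Real.norm_eq_abs]
      have := abs_add_le (y - x) x
      rw [sub_add_cancel] at this
      linarith)
    refine ⟨p, hp, ?_⟩
    rw [← hpy, real_inner_comm]
    simp
  have hxint : x ∈ interior (Set.univ : Set ℝ) := by simp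
  have hr := hu.convexOn.hasDerivWithinAt_rightDeriv_of_mem_interior hxint
  have hl := hu.convexOn.hasDerivWithinAt_leftDeriv_of_mem_interior hxint
  obtain ⟨p, hp, hpx, hpd⟩ := exists_slope_eq hu.continuous (by simp) hnear hr
  obtain ⟨q, hq, hqx, hqd⟩ := exists_slope_eq hu.continuous (by simp) hnear hl
  rw [← hpd] at hr
  rw [← hqd] at hl
  refine ⟨p, hp, q, hq, hpx, hqx, ?_, hr, hl⟩
  refine ge_of_tendsto ((hasDerivWithinAt_iff_tendsto_slope' (by simp)).1 hr) ?_
  filter_upwards [self_mem_nhdsWithin] with y hy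
  have h3 := h1 q hq y
  rw [real_inner_comm] at h3
  simp only [RCLike.inner_apply, conj_trivial] at h3
  rw [slope_def_field, le_div_iff₀ (sub_pos.2 hy), ← hqx]
  linarith

theorem J_nonneg (hu : IsLocMaxAffine u) (x : ℝ) : 0 ≤ J u x 1 := by
  obtain ⟨s, hs⟩ := hu.exists_lines |x|
  obtain ⟨p, -, q, -, -, -, hqp, h1, h2⟩ := hs x le_rfl
  rw [J_eq_sub h1 h2]
  linarith

theorem J_zero_sub (hu : IsLocMaxAffine u) (x : ℝ) : J (fun y => 0 - u y) x 1 = - J u x 1 := by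
  obtain ⟨s, hs⟩ := hu.exists_lines |x|
  obtain ⟨p, -, q, -, -, -, hqp, h1, h2⟩ := hs x le_rfl
  rw [J_eq_sub h1 h2, J_eq_sub (h1.const_sub 0) (h2.const_sub 0)]
  ring

end IsLocMaxAffine

/-- The hinge at `k` has its unit slope jump at `k` itself: the derivative from the right sees `k ≤
x`, the one from the left only `k < x`. Hinges serve to cancel the kinks of `u`. -/
theorem hasDerivWithinAt_max_sub_Ioi (k x : ℝ) :
    HasDerivWithinAt (fun t => max (t - k) 0) (if k ≤ x then 1 else 0) (Set.Ioi x) x := by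
  split_ifs with h
  · refine (((hasDerivAt_id x).sub_const k).hasDerivWithinAt).congr (fun y hy => ?_) ?_
    · exact max_eq_left (sub_nonneg.2 (h.trans (le_of_lt hy)))
    · exact max_eq_left (sub_nonneg.2 h)
  · have h' := not_le.1 h
    refine ((hasDerivAt_const x (0 : ℝ)).congr_of_eventuallyEq ?_).hasDerivWithinAt
    filter_upwards [Iio_mem_nhds h'] with y hy
    exact max_eq_right (sub_nonpos.2 (le_of_lt hy))

theorem hasDerivWithinAt_max_sub_Iio (k x : ℝ) :
    HasDerivWithinAt (fun t => max (t - k) 0) (if k < x then 1 else 0) (Set.Iio x) x := by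
  split_ifs with h
  · refine (((hasDerivAt_id x).sub_const k).congr_of_eventuallyEq ?_).hasDerivWithinAt
    filter_upwards [Ioi_mem_nhds h] with y hy
    exact max_eq_left (sub_nonneg.2 (le_of_lt hy))
  · have h' := not_lt.1 h
    refine ((hasDerivAt_const x (0 : ℝ)).hasDerivWithinAt).congr (fun y hy => ?_) ?_
    · exact max_eq_right (sub_nonpos.2 ((le_of_lt hy).trans h'))
    · exact max_eq_right (sub_nonpos.2 h')

/-- A differentiable function on an interval whose derivative takes finitely many values is
affine. -/
theorem exists_affine_of_finite_deriv {w : ℝ → ℝ} {a b : ℝ} {S : Set ℝ} (hS : S.Finite)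
    (hw : ∀ x ∈ Set.Icc a b, ∃ c ∈ S, HasDerivAt w c x) :
    ∃ β, ∀ x ∈ Set.Icc a b, w x = w a + β * (x - a) := by
  choose! w' hw'S hw' using hw
  have hfin : (w' '' Set.Icc a b).Finite :=
    hS.subset (Set.image_subset_iff.2 fun x hx => hw'S x hx)
  -- By Darboux the values of the derivative form an order-connected set; being finite, it has at
  -- most one point.
  have hoc := Set.OrdConnected.image_hasDerivWithinAt (f := w) Set.ordConnected_Icc
    fun x hx => (hw' x hx).hasDerivWithinAt
  have hsub : ∀ x ∈ Set.Icc a b, ∀ y ∈ Set.Icc a b, w' x ≤ w' y := by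
    intro x hx y hy
    by_contra! hlt
    exact (Set.Icc_infinite hlt) (hfin.subset
      (hoc.out (Set.mem_image_of_mem _ hy) (Set.mem_image_of_mem _ hx)))
  refine ⟨w' a, fun x hx => ?_⟩
  have ha : a ∈ Set.Icc a b := ⟨le_rfl, hx.1.trans hx.2⟩
  have hd : ∀ y ∈ Set.Icc a b, HasDerivAt (fun y => w y - w' a * (y - a)) 0 y := by
    intro y hy
    have h1 := (hw' y hy).sub (((hasDerivAt_id y).sub_const a).const_mul (w' a))
    have h2 : w' y = w' a := le_antisymm (hsub y hy a ha) (hsub a ha y hy)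
    rwa [h2, mul_one, sub_self] at h1
  have := constant_of_has_deriv_right_zero
    (fun y hy => (hd y hy).continuousAt.continuousWithinAt)
    (fun y hy => (hd y (Set.Ico_subset_Icc_self hy)).hasDerivWithinAt) x hx
  simp only [sub_self, mul_zero, sub_zero] at this
  linarith

/-- The second difference at 0 of a hinge depends only on `|k|`; this produces the weights in
Jensen's formula. -/
theorem max_sub_add_max_neg_sub {r : ℝ} (hr : 0 ≤ r) (k : ℝ) :
    max (r - k) 0 + max (-r - k) 0 - 2 * max (0 - k) 0 = max (r - |k|) 0 := by
  rcases le_total 0 k with hk | hk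
  · rw [abs_of_nonneg hk, max_eq_right (by linarith : -r - k ≤ 0),
      max_eq_right (by linarith : 0 - k ≤ 0)]
    ring
  · rw [abs_of_nonpos hk, max_eq_left (by linarith : 0 ≤ r - k),
      max_eq_left (by linarith : 0 ≤ 0 - k)]
    rcases le_total (-r - k) 0 with h | h
    · rw [max_eq_right h, max_eq_left (by linarith)]; ring
    · rw [max_eq_left h, max_eq_right (by linarith)]; ring

/-- The kinks of `u` in `[-R, R]`, together with the one-dimensional Jensen formula. -/
theorem IsLocMaxAffine.exists_kinks {u : ℝ → ℝ} (hu : IsLocMaxAffine u) (R : ℝ) :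
    ∃ K : Finset ℝ, (∀ x, |x| ≤ R → J u x 1 ≠ 0 → x ∈ K) ∧
      ∀ r, 0 ≤ r → r ≤ R →
        u r + u (-r) - 2 * u 0 = ∑ k ∈ K, J u k 1 * max (r - |k|) 0 := by
  classical
  obtain ⟨s, hs⟩ := hu.exists_lines R
  -- At a kink two active pieces of different slopes cross. Superfluous points of `K` are harmless:
  -- inside `[-R, R]` they have `J = 0`, and outside it `max (r - |k|) 0` vanishes.
  set K : Finset ℝ := (s ×ˢ s).image (fun p => (p.2.1 - p.1.1) / (p.1.2 - p.2.2)) with hK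
  have hKmem : ∀ x, |x| ≤ R → J u x 1 ≠ 0 → x ∈ K := by
    intro x hx hJ
    obtain ⟨p, hp, q, hq, hpx, hqx, -, h1, h2⟩ := hs x hx
    rw [J_eq_sub h1 h2] at hJ
    refine Finset.mem_image.2 ⟨(p, q), Finset.mem_product.2 ⟨hp, hq⟩, ?_⟩
    rw [div_eq_iff hJ]
    linear_combination hqx - hpx
  refine ⟨K, hKmem, ?_⟩
  -- Subtracting the weighted hinges removes every kink in `[-R, R]`. Then `w` is differentiable
  -- with finitely many slopes, hence affine, and its second difference at 0 is zero.
  set w : ℝ → ℝ := fun t => u t - ∑ k ∈ K, J u k 1 * max (t - k) 0 with hw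
  have hwd : ∀ x ∈ Set.Icc (-R) R, ∃ c ∈ ((s ×ˢ K.powerset).image
      (fun p => p.1.2 - ∑ k ∈ p.2, J u k 1) : Set ℝ), HasDerivAt w c x := by
    intro x hx
    have hx' : |x| ≤ R := abs_le.2 hx
    obtain ⟨p, hp, q, hq, hpx, hqx, -, h1, h2⟩ := hs x hx'
    refine ⟨p.2 - ∑ k ∈ K.filter (· ≤ x), J u k 1, ?_, ?_⟩
    · exact Finset.mem_coe.2 (Finset.mem_image.2 ⟨(p, K.filter (· ≤ x)),
        Finset.mem_product.2 ⟨hp, Finset.mem_powerset.2 (Finset.filter_subset _ _)⟩, rfl⟩)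
    · have e1 := h1.sub (HasDerivWithinAt.fun_sum fun k (_ : k ∈ K) =>
        (hasDerivWithinAt_max_sub_Ioi k x).const_mul (J u k 1))
      have e2 := h2.sub (HasDerivWithinAt.fun_sum fun k (_ : k ∈ K) =>
        (hasDerivWithinAt_max_sub_Iio k x).const_mul (J u k 1))
      have hsum1 : ∑ k ∈ K, J u k 1 * (if k ≤ x then 1 else 0) =
          ∑ k ∈ K.filter (· ≤ x), J u k 1 := by
        rw [Finset.sum_filter]
        exact Finset.sum_congr rfl fun k _ => by split_ifs <;> simp
      -- The jump of the hinge sum at `x` is `J u x 1`, which is also the jump `p.2 - q.2` of `u`;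
      -- the one-sided derivatives of `w` therefore agree.
      have hsum2 : ∑ k ∈ K, J u k 1 * (if k ≤ x then 1 else 0) =
          ∑ k ∈ K, J u k 1 * (if k < x then 1 else 0) + J u x 1 := by
        have hxs : ∑ k ∈ K, (if k = x then J u k 1 else 0) = J u x 1 := by
          rw [Finset.sum_ite_eq' K x (fun k => J u k 1)]
          split_ifs with h
          · rfl
          · by_contra h0
            exact h (hKmem x hx' (Ne.symm h0))
        rw [← hxs, ← Finset.sum_add_distrib]
        refine Finset.sum_congr rfl fun k _ => ?_
        rcases lt_trichotomy k x with h | h | h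
        · simp [h, h.le, h.ne]
        · simp [h]
        · simp [h.not_ge, h.not_gt, h.ne']
      have hq2 : q.2 - ∑ k ∈ K, J u k 1 * (if k < x then 1 else 0) =
          p.2 - ∑ k ∈ K.filter (· ≤ x), J u k 1 := by
        rw [← hsum1, hsum2, J_eq_sub h1 h2]
        ring
      rw [hsum1] at e1
      rw [hq2] at e2
      have e3 := (e1.Ici_of_Ioi).union (e2.Iic_of_Iio)
      rw [Set.Ici_union_Iic] at e3
      exact hasDerivWithinAt_univ.1 e3
  obtain ⟨β, hβ⟩ := exists_affine_of_finite_deriv (Finset.finite_toSet _) hwd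
  intro r hr hrR
  have a1 := hβ r ⟨by linarith, hrR⟩
  have a2 := hβ (-r) ⟨by linarith, by linarith⟩
  have a3 := hβ 0 ⟨by linarith, by linarith⟩
  have hsum : ∑ k ∈ K, J u k 1 * max (r - |k|) 0 = ∑ k ∈ K, J u k 1 * max (r - k) 0 +
      ∑ k ∈ K, J u k 1 * max (-r - k) 0 - 2 * ∑ k ∈ K, J u k 1 * max (0 - k) 0 := by
    rw [Finset.mul_sum, ← Finset.sum_add_distrib, ← Finset.sum_sub_distrib]
    exact Finset.sum_congr rfl fun k _ => by rw [← max_sub_add_max_neg_sub hr k]; ring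
  simp only [hw] at a1 a2 a3
  rw [hsum]
  linarith

/-- `K` confines the support of the `finsum` to a finite set, so it is a genuine sum and not its
default value 0. -/
theorem IsLocMaxAffine.polesOnLine_eq {u : ℝ → ℝ} (hu : IsLocMaxAffine u) {R t : ℝ} (ht : t ≤ R)
    {K : Finset ℝ} (hK : ∀ x, |x| ≤ R → J u x 1 ≠ 0 → x ∈ K) :
    polesOnLine t (fun y => 0 - u y) = ∑ k ∈ K, J u k 1 * (if |k| < t then 1 else 0) := by
  rw [polesOnLine]
  simp only [hu.J_zero_sub, abs_neg, abs_of_nonneg (hu.J_nonneg _), neg_lt_zero]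
  rw [finsum_mem_eq_sum_of_inter_support_eq (t := K.filter (fun k => |k| < t))]
  · rw [Finset.sum_filter]
    exact Finset.sum_congr rfl fun k _ => by split_ifs <;> simp
  · ext x
    simp only [Set.mem_inter_iff, Set.mem_ofPred_eq, Function.mem_support, Finset.coe_filter]
    constructor
    · rintro ⟨⟨h1, h2⟩, h3⟩
      exact ⟨⟨hK x (h1.le.trans ht) h3, h1⟩, h3⟩
    · rintro ⟨⟨h1, h2⟩, h3⟩
      exact ⟨⟨h2, lt_of_le_of_ne (hu.J_nonneg x) (Ne.symm h3)⟩, h3⟩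

/-! ### Spherical means -/

instance (n : ℕ) : IsFiniteMeasure (sphereMeasure n) := by
  unfold sphereMeasure; infer_instance

instance (n : ℕ) : (sphereMeasure n).IsOpenPosMeasure := by
  unfold sphereMeasure; infer_instance

theorem sphereArea_pos {n : ℕ} (hn : 0 < n) : 0 < sphereArea n := by
  rw [sphereArea_eq n hn]
  have : (0 : ℝ) < n := by exact_mod_cast hn
  have := Real.Gamma_pos_of_pos (show (0 : ℝ) < (n : ℝ) / 2 by positivity)
  positivity

/-- `toSphere` measures a set by the volume of the cone over it, and Lebesgue measure is invariant
under negation. -/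
theorem measurePreserving_neg_sphere (n : ℕ) :
    MeasurePreserving (fun θ : Metric.sphere (0 : Euc n) 1 => -θ) (sphereMeasure n)
      (sphereMeasure n) := by
  have hmeas : Measurable (fun θ : Metric.sphere (0 : Euc n) 1 => -θ) :=
    continuous_neg.measurable
  refine ⟨hmeas, ?_⟩
  ext s hs
  rw [Measure.map_apply hmeas hs, sphereMeasure, Measure.toSphere_apply' _ hs,
    Measure.toSphere_apply' _ (hmeas hs)]
  congr 1
  rw [← Measure.measure_neg]
  congr 1
  ext x
  simp only [Set.mem_neg, Set.mem_smul, Set.mem_image, Set.mem_preimage]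
  constructor
  · rintro ⟨a, ha, y, ⟨θ, hθ, rfl⟩, hx⟩
    exact ⟨a, ha, _, ⟨-θ, hθ, rfl⟩, by rw [coe_neg_sphere, smul_neg, hx, neg_neg]⟩
  · rintro ⟨a, ha, y, ⟨θ, hθ, rfl⟩, hx⟩
    exact ⟨a, ha, _, ⟨-θ, by simpa using hθ, rfl⟩, by rw [coe_neg_sphere, smul_neg, hx]⟩

theorem sphereMean_comp_neg {n : ℕ} (u : Euc n → ℝ) :
    sphereMean n (fun θ => u (-θ)) = sphereMean n u := by
  rw [sphereMean, sphereMean]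
  congr 1
  exact (measurePreserving_neg_sphere n).integral_comp
    (Homeomorph.neg (Metric.sphere (0 : Euc n) 1)).measurableEmbedding
    (fun θ : Metric.sphere (0 : Euc n) 1 => u θ)

theorem integrable_sphere {n : ℕ} {u : Euc n → ℝ} (hu : Continuous u) :
    Integrable (fun θ : Metric.sphere (0 : Euc n) 1 => u θ) (sphereMeasure n) :=
  (hu.comp continuous_subtype_val).integrable_of_hasCompactSupport
    (HasCompactSupport.of_compactSpace _)

section sphereMean

variable {n : ℕ} {u v : Euc n → ℝ}

theorem sphereMean_const (hn : 0 < n) (a : ℝ) : sphereMean n (fun _ => a) = a := by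
  have := (sphereArea_pos hn).ne'
  rw [sphereMean, integral_const, smul_eq_mul]
  change 1 / sphereArea n * (sphereArea n * a) = a
  field_simp

theorem sphereMean_add (hu : Continuous u) (hv : Continuous v) :
    sphereMean n (fun θ => u θ + v θ) = sphereMean n u + sphereMean n v := by
  rw [sphereMean, integral_add (integrable_sphere hu) (integrable_sphere hv), mul_add]
  rfl

theorem sphereMean_sub (hu : Continuous u) (hv : Continuous v) :
    sphereMean n (fun θ => u θ - v θ) = sphereMean n u - sphereMean n v := by
  rw [sphereMean, integral_sub (integrable_sphere hu) (integrable_sphere hv), mul_sub]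
  rfl

theorem sphereMean_const_mul (a : ℝ) : sphereMean n (fun θ => a * u θ) = a * sphereMean n u := by
  rw [sphereMean, sphereMean, integral_const_mul]
  ring

theorem sphereMean_sum {ι : Type*} (s : Finset ι) {U : ι → Euc n → ℝ}
    (hU : ∀ i ∈ s, Continuous (U i)) :
    sphereMean n (fun θ => ∑ i ∈ s, U i θ) = ∑ i ∈ s, sphereMean n (U i) := by
  rw [sphereMean, integral_finsetSum s fun i hi => integrable_sphere (hU i hi), Finset.mul_sum]
  rfl

theorem sphereMean_mono (hn : 0 < n) (hu : Continuous u) (hv : Continuous v)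
    (h : ∀ θ, ‖θ‖ = 1 → u θ ≤ v θ) : sphereMean n u ≤ sphereMean n v :=
  mul_le_mul_of_nonneg_left
    (integral_mono (integrable_sphere hu) (integrable_sphere hv)
      fun θ => h θ (by simp))
    (one_div_nonneg.2 (sphereArea_pos hn).le)

theorem abs_sphereMean_le (hn : 0 < n) : |sphereMean n u| ≤ sphereMean n (fun θ => |u θ|) := by
  rw [sphereMean, abs_mul, abs_of_pos (one_div_pos.2 (sphereArea_pos hn))]
  exact mul_le_mul_of_nonneg_left abs_integral_le_integral_abs
    (one_div_nonneg.2 (sphereArea_pos hn).le)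

end sphereMean

/-! ### Jensen's formula in several variables -/

/-- The difference between the mean of `g` over the sphere of radius `r` and `g 0`. -/
noncomputable def excess {n : ℕ} (g : Euc n → ℝ) (r : ℝ) : ℝ :=
  sphereMean n (fun θ => g (r • θ)) - g 0

theorem setIntegral_ite_lt {a r : ℝ} (ha : 0 ≤ a) :
    ∫ t in Set.Ioc 0 r, (if a < t then (1 : ℝ) else 0) = max (r - a) 0 := by
  have h1 : (fun t : ℝ => if a < t then (1 : ℝ) else 0) =
      (Set.Ioi a).indicator (fun _ => (1 : ℝ)) := by
    ext t; simp [Set.indicator_apply]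
  rw [h1, setIntegral_indicator measurableSet_Ioi, setIntegral_const, Set.Ioc_inter_Ioi,
    max_eq_right ha, Measure.real, Real.volume_Ioc, ENNReal.toReal_ofReal', smul_eq_mul, mul_one]

theorem integrableOn_ite_lt (a r : ℝ) :
    IntegrableOn (fun t : ℝ => if a < t then (1 : ℝ) else 0) (Set.Ioc 0 r) := by
  refine Integrable.of_bound (C := 1) ?_ (Eventually.of_forall fun t => ?_)
  · exact (Measurable.ite measurableSet_Ioi measurable_const measurable_const).aestronglyMeasurable
  · split_ifs <;> simp

theorem tendsto_mul_max_sub (a t : ℝ) :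
    Tendsto (fun k : ℕ => ((k : ℝ) + 1) * (max (t - a) 0 - max (t - 1 / ((k : ℝ) + 1) - a) 0))
      atTop (𝓝 (if a < t then 1 else 0)) := by
  refine tendsto_const_nhds.congr' ?_
  split_ifs with h
  · filter_upwards [tendsto_one_div_add_atTop_nhds_zero_nat.eventually_lt_const (sub_pos.2 h)]
      with k hk
    have hk0 : (k : ℝ) + 1 ≠ 0 := by positivity
    rw [max_eq_left (by linarith), max_eq_left (by linarith)]
    field_simp
    ring
  · refine Eventually.of_forall fun k => ?_
    have h' := not_lt.1 h
    have : 0 < 1 / ((k : ℝ) + 1) := by positivity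
    dsimp only
    rw [max_eq_right (by linarith : t - a ≤ 0),
      max_eq_right (by linarith : t - 1 / ((k : ℝ) + 1) - a ≤ 0)]
    simp

namespace IsLocMaxAffine

/-- The root count is the left derivative of `t ↦ u t + u (-t)`. Written as a limit of difference
quotients, it is seen to be measurable jointly in radius and direction. -/
theorem tendsto_polesOnLine {u : ℝ → ℝ} (hu : IsLocMaxAffine u) {t : ℝ} (ht : 0 < t) :
    Tendsto (fun k : ℕ => ((k : ℝ) + 1) * ((u t + u (-t)) -
      (u (t - 1 / ((k : ℝ) + 1)) + u (-(t - 1 / ((k : ℝ) + 1)))))) atTop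
      (𝓝 (polesOnLine t (fun y => 0 - u y))) := by
  obtain ⟨K, hK, hsum⟩ := hu.exists_kinks t
  rw [hu.polesOnLine_eq le_rfl hK]
  refine (tendsto_finsetSum K fun k _ => (tendsto_mul_max_sub |k| t).const_mul (J u k 1)).congr' ?_
  filter_upwards [tendsto_one_div_add_atTop_nhds_zero_nat.eventually_lt_const ht] with k hk
  have : 0 < 1 / ((k : ℝ) + 1) := by positivity
  have h1 := hsum t ht.le le_rfl
  have h2 := hsum (t - 1 / ((k : ℝ) + 1)) (by linarith) (by linarith)
  have h3 : (u t + u (-t)) - (u (t - 1 / ((k : ℝ) + 1)) + u (-(t - 1 / ((k : ℝ) + 1)))) =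
      ∑ i ∈ K, J u i 1 * max (t - |i|) 0 -
        ∑ i ∈ K, J u i 1 * max (t - 1 / ((k : ℝ) + 1) - |i|) 0 := by linarith
  rw [h3, ← Finset.sum_sub_distrib, Finset.mul_sum]
  exact Finset.sum_congr rfl fun i _ => by ring

/-- With radius `r + 1` every kink counted has weight `r + 1 - |k| ≥ 1`. The bound makes the count
integrable, as Fubini requires. -/
theorem polesOnLine_bounds {u : ℝ → ℝ} (hu : IsLocMaxAffine u) {t r : ℝ} (hr : 0 ≤ r)
    (ht : t ≤ r) : 0 ≤ polesOnLine t (fun y => 0 - u y) ∧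
      polesOnLine t (fun y => 0 - u y) ≤ u (r + 1) + u (-(r + 1)) - 2 * u 0 := by
  obtain ⟨K, hK, hsum⟩ := hu.exists_kinks (r + 1)
  rw [hu.polesOnLine_eq (by linarith) hK, hsum (r + 1) (by linarith) le_rfl]
  refine ⟨Finset.sum_nonneg fun k _ => mul_nonneg (hu.J_nonneg k) (by split_ifs <;> simp),
    Finset.sum_le_sum fun k _ => mul_le_mul_of_nonneg_left ?_ (hu.J_nonneg k)⟩
  split_ifs with h
  · exact le_max_of_le_left (by linarith)
  · exact le_max_right _ _

theorem setIntegral_polesOnLine {u : ℝ → ℝ} (hu : IsLocMaxAffine u) {r : ℝ} (hr : 0 ≤ r) :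
    ∫ t in Set.Ioc 0 r, polesOnLine t (fun y => 0 - u y) = u r + u (-r) - 2 * u 0 := by
  obtain ⟨K, hK, hsum⟩ := hu.exists_kinks r
  rw [hsum r hr le_rfl, setIntegral_congr_fun measurableSet_Ioc
    (g := fun t => ∑ k ∈ K, J u k 1 * (if |k| < t then 1 else 0))
    (fun t ht => hu.polesOnLine_eq ht.2 hK), integral_finsetSum]
  · exact Finset.sum_congr rfl fun k _ => by
      rw [integral_const_mul, setIntegral_ite_lt (abs_nonneg k)]
  · exact fun k _ => (integrableOn_ite_lt |k| r).const_mul _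

/-- **Jensen's formula** for locally finite maxima of affine functions. -/
theorem countingRoots_eq {n : ℕ} (hn : 0 < n) {g : Euc n → ℝ} (hg : IsLocMaxAffine g) {r : ℝ}
    (hr : 0 ≤ r) : countingRoots r g = excess g r := by
  have hc := hg.continuous
  have hline : ∀ θ : Euc n, IsLocMaxAffine (fun s : ℝ => g (s • θ)) := hg.comp_smul_right
  set φ : ℝ → Metric.sphere (0 : Euc n) 1 → ℝ :=
    fun t θ => polesOnLine t (fun s : ℝ => 0 - g (s • (θ : Euc n))) with hφ
  have hpos : ∀ᵐ p ∂((volume.restrict (Set.Ioc 0 r)).prod (sphereMeasure n)),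
      p.1 ∈ Set.Ioc 0 r :=
    Measure.quasiMeasurePreserving_fst.ae (ae_restrict_mem measurableSet_Ioc)
  have hmeas : AEStronglyMeasurable (Function.uncurry φ)
      ((volume.restrict (Set.Ioc 0 r)).prod (sphereMeasure n)) := by
    refine aestronglyMeasurable_of_tendsto_ae atTop (f := fun (k : ℕ) p => ((k : ℝ) + 1) *
      ((g (p.1 • (p.2 : Euc n)) + g ((-p.1) • (p.2 : Euc n))) -
      (g ((p.1 - 1 / ((k : ℝ) + 1)) • (p.2 : Euc n)) +
        g ((-(p.1 - 1 / ((k : ℝ) + 1))) • (p.2 : Euc n))))) (fun k => ?_) ?_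
    · refine Continuous.aestronglyMeasurable ?_
      fun_prop
    · filter_upwards [hpos] with p hp
      exact (hline p.2).tendsto_polesOnLine hp.1
  obtain ⟨C, hC⟩ : ∃ C, ∀ θ : Metric.sphere (0 : Euc n) 1,
      g ((r + 1) • (θ : Euc n)) + g ((-(r + 1)) • (θ : Euc n)) - 2 * g ((0 : ℝ) • (θ : Euc n))
        ≤ C := by
    obtain ⟨C, hC⟩ := (isCompact_range (f := fun θ : Metric.sphere (0 : Euc n) 1 =>
      g ((r + 1) • (θ : Euc n)) + g ((-(r + 1)) • (θ : Euc n)) - 2 * g ((0 : ℝ) • (θ : Euc n)))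
      (by fun_prop)).bddAbove
    exact ⟨C, fun θ => hC ⟨θ, rfl⟩⟩
  have hint : Integrable (Function.uncurry φ)
      ((volume.restrict (Set.Ioc 0 r)).prod (sphereMeasure n)) := by
    refine Integrable.of_bound hmeas C ?_
    filter_upwards [hpos] with p hp
    have hb := (hline p.2).polesOnLine_bounds hr hp.2
    rw [Real.norm_eq_abs, Function.uncurry, abs_of_nonneg hb.1]
    exact hb.2.trans (hC p.2)
  have hswap := integral_integral_swap hint
  have hinner : ∀ θ : Metric.sphere (0 : Euc n) 1, ∫ t in Set.Ioc 0 r, φ t θ =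
      g (r • (θ : Euc n)) + g (r • (-(θ : Euc n))) - 2 * g 0 := by
    intro θ
    have := (hline θ).setIntegral_polesOnLine hr
    simp only [zero_smul] at this
    rw [this, smul_neg, neg_smul]
  simp only [hinner] at hswap
  have h1 : ∫ t in (0 : ℝ)..r, poleCount t (fun x => 0 - g x) =
      sphereMean n (fun θ => g (r • θ) + g (r • (-θ)) - 2 * g 0) := by
    rw [intervalIntegral.integral_of_le hr, sphereMean, ← hswap, ← integral_const_mul]
    rfl
  -- The directions `θ` and `-θ` give equal means, so the integral is twice the excess; this cancels
  -- the factor `1/2` in `countingN`.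
  rw [countingRoots, countingN, h1, sphereMean_sub (by fun_prop) (by fun_prop),
    sphereMean_add (by fun_prop) (by fun_prop), sphereMean_const hn,
    sphereMean_comp_neg (fun θ => g (r • θ)), excess]
  ring

end IsLocMaxAffine

/-! ### Algebra and growth of the excess -/

section excess

variable {n : ℕ} {g h : Euc n → ℝ}

theorem excess_sub (hg : Continuous g) (hh : Continuous h) (r : ℝ) :
    excess (fun x => g x - h x) r = excess g r - excess h r := by
  rw [excess, sphereMean_sub (by fun_prop) (by fun_prop), excess, excess]
  ring

theorem excess_const_mul (a : ℝ) (r : ℝ) : excess (fun x => a * g x) r = a * excess g r := by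
  rw [excess, sphereMean_const_mul, excess]
  ring

theorem excess_sum {ι : Type*} (s : Finset ι) {G : ι → Euc n → ℝ}
    (hG : ∀ i ∈ s, Continuous (G i)) (r : ℝ) :
    excess (fun x => ∑ i ∈ s, G i x) r = ∑ i ∈ s, excess (G i) r := by
  rw [excess, sphereMean_sum s (U := fun i θ => G i (r • θ)) fun i hi =>
    (hG i hi).comp (by fun_prop), ← Finset.sum_sub_distrib]
  rfl

/-- A linear form is odd and the surface measure is even. Supporting affine functions can thus be
subtracted without changing the excess. -/
theorem excess_affine (hn : 0 < n) (a : ℝ) (v : Euc n) (r : ℝ) :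
    excess (fun x => a + inner ℝ v x) r = 0 := by
  have h1 := sphereMean_comp_neg (fun θ : Euc n => inner ℝ v (r • θ))
  have h2 : sphereMean n (fun θ => inner ℝ v (r • (-θ))) =
      (-1) * sphereMean n (fun θ => inner ℝ v (r • θ)) := by
    rw [← sphereMean_const_mul]
    simp
  rw [excess, sphereMean_add (by fun_prop) (by fun_prop), sphereMean_const hn, inner_zero_right]
  linarith

theorem excess_mono_of_le (hn : 0 < n) (hg : Continuous g) (hh : Continuous h) {C : ℝ}
    (hle : ∀ x, g x ≤ h x + C) (r : ℝ) : excess g r ≤ excess h r + (h 0 + C - g 0) := by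
  have h1 := sphereMean_mono hn (u := fun θ => g (r • θ)) (v := fun θ => h (r • θ) + C)
    (by fun_prop) (by fun_prop) fun θ _ => hle (r • θ)
  rw [sphereMean_add (by fun_prop) (by fun_prop), sphereMean_const hn] at h1
  rw [excess, excess]
  linarith

end excess

namespace IsLocMaxAffine

variable {n : ℕ} {g : Euc n → ℝ}

/-- Subtraction of a supporting affine function at the origin. -/
theorem exists_normalized (hn : 0 < n) (hg : IsLocMaxAffine g) :
    ∃ v : Euc n, IsLocMaxAffine (fun x => g x - (g 0 + inner ℝ v x)) ∧
      (∀ x, 0 ≤ g x - (g 0 + inner ℝ v x)) ∧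
      ∀ r, sphereMean n (fun θ => g (r • θ) - (g 0 + inner ℝ v (r • θ))) = excess g r := by
  obtain ⟨v, hv⟩ := hg.exists_affine_le 0
  have hc := hg.continuous
  refine ⟨v, ?_, fun x => ?_, fun r => ?_⟩
  · convert hg.add (affine (-g 0) (-v)) using 2 with x
    rw [inner_neg_left]
    ring
  · have := hv x
    rw [sub_zero] at this
    linarith
  · have h1 := excess_affine hn (g 0) v r
    rw [excess, inner_zero_right] at h1
    rw [sphereMean_sub (by fun_prop) (by fun_prop), excess]
    linarith

theorem excess_nonneg (hn : 0 < n) (hg : IsLocMaxAffine g) (r : ℝ) : 0 ≤ excess g r := by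
  obtain ⟨v, hv1, hv2, hv3⟩ := hg.exists_normalized hn
  have hc := hv1.continuous
  rw [← hv3, ← sphereMean_const hn 0]
  exact sphereMean_mono hn (by fun_prop) (hc.comp (by fun_prop : Continuous fun θ : Euc n => r • θ))
    fun θ _ => hv2 _

theorem excess_zero (hn : 0 < n) (g : Euc n → ℝ) : excess g 0 = 0 := by
  simp [excess, sphereMean_const hn]

theorem convexOn_excess (hn : 0 < n) (hg : IsLocMaxAffine g) :
    ConvexOn ℝ Set.univ (excess g) := by
  have hc := hg.continuous
  refine ⟨convex_univ, fun x _ y _ a b ha hb hab => ?_⟩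
  have h1 := sphereMean_mono hn (u := fun θ => g ((a * x + b * y) • θ))
    (v := fun θ => a * g (x • θ) + b * g (y • θ)) (by fun_prop) (by fun_prop) fun θ _ => by
      have := hg.convexOn.2 (Set.mem_univ (x • θ)) (Set.mem_univ (y • θ)) ha hb hab
      simpa [add_smul, mul_smul] using this
  rw [sphereMean_add (by fun_prop) (by fun_prop), sphereMean_const_mul (u := fun θ => g (x • θ)),
    sphereMean_const_mul (u := fun θ => g (y • θ))] at h1
  have h2 : a * g 0 + b * g 0 = g 0 := by rw [← add_mul, hab, one_mul]
  simp only [excess, smul_eq_mul]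
  linarith

theorem continuous_excess (hn : 0 < n) (hg : IsLocMaxAffine g) : Continuous (excess g) :=
  (hg.convexOn_excess hn).locallyLipschitz.continuous

/-- The excess is convex in the radius and vanishes at 0, so its quotient by the radius is
nondecreasing. -/
theorem mul_excess_le (hn : 0 < n) (hg : IsLocMaxAffine g) {r s : ℝ} (hr : 0 ≤ r) (hrs : r ≤ s) :
    s * excess g r ≤ r * excess g s := by
  rcases (hr.trans hrs).eq_or_lt with hs | hs
  · obtain rfl : r = 0 := le_antisymm (hs ▸ hrs) hr
    simp [← hs]
  · have h := (hg.convexOn_excess hn).2 (Set.mem_univ s) (Set.mem_univ 0)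
      (div_nonneg hr hs.le) (sub_nonneg.2 ((div_le_one hs).2 hrs)) (by ring)
    simp only [smul_eq_mul, mul_zero, add_zero, excess_zero hn, div_mul_cancel₀ r hs.ne'] at h
    calc s * excess g r ≤ s * (r / s * excess g s) := mul_le_mul_of_nonneg_left h hs.le
      _ = r * excess g s := by field_simp

theorem excess_mono (hn : 0 < n) (hg : IsLocMaxAffine g) {r s : ℝ} (hr : 0 ≤ r) (hrs : r ≤ s) :
    excess g r ≤ excess g s := by
  rcases (hr.trans hrs).eq_or_lt with hs | hs
  · obtain rfl : r = s := le_antisymm hrs (hs ▸ hr)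
    exact le_rfl
  · refine le_of_mul_le_mul_left ((hg.mul_excess_le hn hr hrs).trans ?_) hs
    exact mul_le_mul_of_nonneg_right hrs (hg.excess_nonneg hn s)

/-- After normalization the function is continuous, nonnegative and of mean zero on each sphere. It
vanishes there because the surface measure charges every nonempty open set. -/
theorem eq_affine_of_excess_eq_zero (hn : 0 < n) (hg : IsLocMaxAffine g)
    (h0 : ∀ r, 0 ≤ r → excess g r = 0) : ∃ v : Euc n, ∀ x, g x = g 0 + inner ℝ v x := by
  obtain ⟨v, hv1, hv2, hv3⟩ := hg.exists_normalized hn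
  refine ⟨v, fun x => ?_⟩
  rcases eq_or_ne x 0 with rfl | hx
  · simp
  have hc : Continuous (fun θ : Metric.sphere (0 : Euc n) 1 =>
      g (‖x‖ • (θ : Euc n)) - (g 0 + inner ℝ v (‖x‖ • (θ : Euc n)))) :=
    hv1.continuous.comp (by fun_prop : Continuous fun θ : Metric.sphere (0 : Euc n) 1 =>
      ‖x‖ • (θ : Euc n))
  have h1 := hv3 ‖x‖
  rw [h0 _ (norm_nonneg x), sphereMean] at h1
  have h2 := (mul_eq_zero.1 h1).resolve_left (one_div_pos.2 (sphereArea_pos hn)).ne'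
  rw [integral_eq_zero_iff_of_nonneg (fun θ => hv2 _)
    (hc.integrable_of_hasCompactSupport (HasCompactSupport.of_compactSpace _))] at h2
  have h3 := congrFun ((hc.ae_eq_iff_eq _ continuous_const).1 h2)
    ⟨‖x‖⁻¹ • x, by simp [norm_smul, hx]⟩
  have h4 : ‖x‖ • ‖x‖⁻¹ • x = x := by 
    rw [smul_smul, mul_inv_cancel₀ (norm_ne_zero_iff.2 hx), one_smul]
  simp only [h4] at h3
  exact sub_eq_zero.1 h3

end IsLocMaxAffine

/-! ### Spherical means of translates -/

/-- Integration in polar coordinates. -/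
theorem lintegral_polar {n : ℕ} (hn : 0 < n) {H : Euc n → ENNReal} (hH : Measurable H) :
    ∫⁻ x, H x = ∫⁻ t in Set.Ioi (0 : ℝ), ENNReal.ofReal (t ^ (n - 1)) *
      ∫⁻ θ : Metric.sphere (0 : Euc n) 1, H (t • (θ : Euc n)) ∂(sphereMeasure n) := by
  have : Nonempty (Fin n) := ⟨⟨0, hn⟩⟩
  have hmp := (volume : Measure (Euc n)).measurePreserving_homeomorphUnitSphereProd
  rw [finrank_euclideanSpace, Fintype.card_fin] at hmp
  have hG : Measurable (fun p : Metric.sphere (0 : Euc n) 1 × Set.Ioi (0 : ℝ) =>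
      H ((p.2 : ℝ) • (p.1 : Euc n))) := hH.comp (by fun_prop)
  have h1 : ∫⁻ x, H x = ∫⁻ x : ({(0 : Euc n)}ᶜ : Set (Euc n)), H x ∂(volume.comap Subtype.val) := by
    rw [lintegral_subtype_comap (measurableSet_singleton _).compl, restrict_compl_singleton]
  have h2 := hmp.lintegral_comp hG
  have h3 : ∀ x : ({(0 : Euc n)}ᶜ : Set (Euc n)),
      (((homeomorphUnitSphereProd (Euc n) x).2 : ℝ) •
        ((homeomorphUnitSphereProd (Euc n) x).1 : Euc n)) = x := by
    intro x
    have hx : ‖(x : Euc n)‖ ≠ 0 := norm_ne_zero_iff.2 x.2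
    simp [smul_smul, hx]
  simp only [h3] at h2
  rw [h1, h2, lintegral_prod_symm _ hG.aemeasurable, Measure.volumeIoiPow,
    lintegral_withDensity_eq_lintegral_mul _ (by fun_prop) hG.lintegral_prod_left',
    ← lintegral_subtype_comap measurableSet_Ioi]
  rfl

section shift

variable {n : ℕ} {h : Euc n → ℝ}

theorem setLIntegral_annulus (hn : 0 < n) (hh : Continuous h) (h0 : ∀ x, 0 ≤ h x) {a b : ℝ}
    (ha : 0 ≤ a) :
    ∫⁻ x in {x : Euc n | ‖x‖ ∈ Set.Ioc a b}, ENNReal.ofReal (h x) =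
      ∫⁻ t in Set.Ioc a b, ENNReal.ofReal
        (t ^ (n - 1) * (sphereArea n * sphereMean n (fun θ => h (t • θ)))) := by
  have hms : MeasurableSet {x : Euc n | ‖x‖ ∈ Set.Ioc a b} :=
    measurableSet_Ioc.preimage measurable_norm
  have hsub : Set.Ioc a b ⊆ Set.Ioi (0 : ℝ) := fun t ht => ha.trans_lt ht.1
  have hind : ∀ F : ℝ → ENNReal, ∫⁻ t in Set.Ioc a b, F t =
      ∫⁻ t in Set.Ioi 0, (Set.Ioc a b).indicator F t := fun F => by
    rw [setLIntegral_indicator measurableSet_Ioc, Set.inter_eq_self_of_subset_left hsub]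
  rw [← lintegral_indicator hms, lintegral_polar hn ((by fun_prop : Measurable fun x =>
    ENNReal.ofReal (h x)).indicator hms), hind]
  refine setLIntegral_congr_fun measurableSet_Ioi fun t ht => ?_
  have hnorm : ∀ θ : Metric.sphere (0 : Euc n) 1, ‖t • (θ : Euc n)‖ = t := fun θ => by
    simp [norm_smul, abs_of_pos (show 0 < t from ht)]
  simp only [Set.indicator_apply, Set.mem_ofPred_eq, hnorm]
  split_ifs with hmem
  · rw [ENNReal.ofReal_mul (pow_nonneg (le_of_lt ht) _)]
    congr 1
    rw [← ofReal_integral_eq_lintegral_ofReal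
      (integrable_sphere (u := fun θ => h (t • θ)) (by fun_prop))
      (Eventually.of_forall fun θ => h0 _), sphereMean]
    have := (sphereArea_pos hn).ne'
    congr 1
    field_simp
  · simp

theorem sphereMean_smul_mono (hn : 0 < n) (hh : IsLocMaxAffine h) {r s : ℝ} (hr : 0 ≤ r)
    (hrs : r ≤ s) :
    sphereMean n (fun θ => h (r • θ)) ≤ sphereMean n (fun θ => h (s • θ)) := by
  have := hh.excess_mono hn hr hrs
  rwa [excess, excess, sub_le_sub_iff_right] at this

theorem sphereMean_nonneg (hn : 0 < n) (h0 : ∀ x, 0 ≤ h x) : 0 ≤ sphereMean n h :=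
  mul_nonneg (one_div_nonneg.2 (sphereArea_pos hn).le) (integral_nonneg fun θ => h0 θ)

/-- Spherical means increase with the radius, so the polar integrand is at least its value at the
inner radius; the outer radius gives the companion upper bound. -/
theorem le_setLIntegral_annulus (hn : 0 < n) (hh : IsLocMaxAffine h) (h0 : ∀ x, 0 ≤ h x)
    {a b : ℝ} (ha : 0 ≤ a) :
    ENNReal.ofReal ((b - a) * (a ^ (n - 1) * (sphereArea n * sphereMean n (fun θ => h (a • θ)))))
      ≤ ∫⁻ x in {x : Euc n | ‖x‖ ∈ Set.Ioc a b}, ENNReal.ofReal (h x) := by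
  have hA := sphereArea_pos hn
  rw [setLIntegral_annulus hn hh.continuous h0 ha, mul_comm,
    ENNReal.ofReal_mul (mul_nonneg (pow_nonneg ha _)
      (mul_nonneg hA.le (sphereMean_nonneg hn fun x => h0 _))), ← Real.volume_Ioc,
    ← setLIntegral_const]
  refine setLIntegral_mono' measurableSet_Ioc fun t ht => ENNReal.ofReal_le_ofReal ?_
  have h1 := sphereMean_smul_mono hn hh ha ht.1.le
  have h2 : 0 ≤ sphereMean n (fun θ => h (a • θ)) := sphereMean_nonneg hn fun x => h0 _
  have h3 := ht.1.le
  have h4 := ha.trans h3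
  gcongr

theorem setLIntegral_annulus_le (hn : 0 < n) (hh : IsLocMaxAffine h) (h0 : ∀ x, 0 ≤ h x)
    {a b : ℝ} (ha : 0 ≤ a) (hab : a ≤ b) :
    ∫⁻ x in {x : Euc n | ‖x‖ ∈ Set.Ioc a b}, ENNReal.ofReal (h x) ≤
    ENNReal.ofReal
      ((b - a) * (b ^ (n - 1) * (sphereArea n * sphereMean n (fun θ => h (b • θ))))) := by
  have hA := sphereArea_pos hn
  rw [setLIntegral_annulus hn hh.continuous h0 ha, mul_comm,
    ENNReal.ofReal_mul (mul_nonneg (pow_nonneg (ha.trans hab) _)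
      (mul_nonneg hA.le (sphereMean_nonneg hn fun x => h0 _))), ← Real.volume_Ioc,
    ← setLIntegral_const]
  refine setLIntegral_mono' measurableSet_Ioc fun t ht => ENNReal.ofReal_le_ofReal ?_
  have h1 := sphereMean_smul_mono hn hh (ha.trans ht.1.le) ht.2
  have h2 : 0 ≤ sphereMean n (fun θ => h (t • θ)) := sphereMean_nonneg hn fun x => h0 _
  have h3 := ht.2
  have h4 := ha.trans ht.1.le
  have h5 := ha.trans hab
  gcongr

/-- Comparison of the mean of a nonnegative convex function over a sphere centred at `w` with the
mean over a larger sphere centred at the origin. -/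
theorem sphereMean_shift_le (hn : 0 < n) (hh : IsLocMaxAffine h) (h0 : ∀ x, 0 ≤ h x)
    {w : Euc n} {ρ r : ℝ} (hρ : 0 < ρ) (hw : ‖w‖ ≤ ρ) (hr : 2 * ρ ≤ r) :
    sphereMean n (fun θ => h (r • θ + w)) ≤
      3 * 2 ^ (n - 1) * sphereMean n (fun θ => h ((r + 2 * ρ) • θ)) := by
  have hA := sphereArea_pos hn
  have hr0 : 0 < r := by linarith
  have h1 := le_setLIntegral_annulus hn (hh.comp_add_right w) (fun x => h0 _) (a := r)
    (b := r + ρ) hr0.le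
  have h2 := setLIntegral_annulus_le hn hh h0 (a := r - ρ) (b := r + 2 * ρ) (by linarith)
    (by linarith)
  -- Translation by `w` carries the annulus `(r, r + ρ]` into `(r - ρ, r + 2ρ]`. The ratio of widths
  -- gives the factor 3, and `r + 2ρ ≤ 2r` gives `2 ^ (n - 1)`.
  have h3 : ∫⁻ x in {x : Euc n | ‖x‖ ∈ Set.Ioc r (r + ρ)}, ENNReal.ofReal (h (x + w)) ≤
      ∫⁻ x in {x : Euc n | ‖x‖ ∈ Set.Ioc (r - ρ) (r + 2 * ρ)}, ENNReal.ofReal (h x) := by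
    have hms : ∀ a b : ℝ, MeasurableSet {x : Euc n | ‖x‖ ∈ Set.Ioc a b} := fun a b =>
      measurableSet_Ioc.preimage measurable_norm
    rw [← lintegral_indicator (hms _ _), ← lintegral_indicator (hms _ _),
      ← lintegral_add_right_eq_self (μ := volume)
        ({x : Euc n | ‖x‖ ∈ Set.Ioc (r - ρ) (r + 2 * ρ)}.indicator _) w]
    refine lintegral_mono fun x => ?_
    by_cases hx : x ∈ {x : Euc n | ‖x‖ ∈ Set.Ioc r (r + ρ)}
    swap
    · rw [Set.indicator_of_notMem hx]
      exact zero_le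
    have ha := norm_add_le x w
    have hb := norm_sub_le (x + w) w
    rw [add_sub_cancel_right] at hb
    have hx' : x + w ∈ {x : Euc n | ‖x‖ ∈ Set.Ioc (r - ρ) (r + 2 * ρ)} := by
      have h5 : r < ‖x‖ := hx.1
      have h6 : ‖x‖ ≤ r + ρ := hx.2
      exact ⟨by linarith, by linarith⟩
    rw [Set.indicator_of_mem hx, Set.indicator_of_mem hx']
  have h4 := h1.trans (h3.trans h2)
  set m := sphereMean n (fun θ => h (r • θ + w))
  have hm' : 0 ≤ sphereMean n (fun θ => h ((r + 2 * ρ) • θ)) := sphereMean_nonneg hn fun x => h0 _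
  set m' := sphereMean n (fun θ => h ((r + 2 * ρ) • θ))
  rw [ENNReal.ofReal_le_ofReal_iff (by
    have : 0 ≤ r + 2 * ρ - (r - ρ) := by linarith
    positivity)] at h4
  have h5 : (r + 2 * ρ) ^ (n - 1) ≤ 2 ^ (n - 1) * r ^ (n - 1) := by
    rw [← mul_pow]
    gcongr
    linarith
  have h6 : ρ * r ^ (n - 1) * sphereArea n * m ≤
      ρ * r ^ (n - 1) * sphereArea n * (3 * 2 ^ (n - 1) * m') := by
    calc ρ * r ^ (n - 1) * sphereArea n * m
        = (r + ρ - r) * (r ^ (n - 1) * (sphereArea n * m)) := by ring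
      _ ≤ (r + 2 * ρ - (r - ρ)) * ((r + 2 * ρ) ^ (n - 1) * (sphereArea n * m')) := h4
      _ = 3 * ρ * ((r + 2 * ρ) ^ (n - 1) * (sphereArea n * m')) := by ring
      _ ≤ 3 * ρ * (2 ^ (n - 1) * r ^ (n - 1) * (sphereArea n * m')) := by gcongr
      _ = _ := by ring
  exact le_of_mul_le_mul_left h6 (by positivity)

/-- A nonnegative convex function varies little under a translation, compared with its values at
distant points. -/
theorem abs_sub_le_of_convexOn {E : Type*} [AddCommGroup E] [Module ℝ E] {h : E → ℝ}
    (hc : ConvexOn ℝ Set.univ h) (h0 : ∀ x, 0 ≤ h x) (v x : E) {L : ℝ} (hL : 1 ≤ L) :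
    |h (x + v) - h x| ≤ 1 / L * (h (x + L • v) + h (x + (-L) • v)) := by
  have hL0 : 0 < L := by linarith
  -- `y + w` lies on the segment from `y` to `y + A • w` with weight `1 / A` at the far end; the
  -- nonnegative term `1 / A * h y` is discarded.
  have key : ∀ (A : ℝ), L ≤ A → ∀ y w : E, h (y + w) - h y ≤ 1 / L * h (y + A • w) := by
    intro A hA y w
    have hA0 : 0 < A := by linarith
    have h1 := hc.2 (Set.mem_univ y) (Set.mem_univ (y + A • w))
      (sub_nonneg.2 ((div_le_one hA0).2 (hL.trans hA)) : 0 ≤ 1 - 1 / A)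
      (by positivity : 0 ≤ 1 / A) (by ring)
    have h2 : (1 - 1 / A) • y + (1 / A) • (y + A • w) = y + w := by
      rw [smul_add, smul_smul, one_div_mul_cancel hA0.ne', one_smul, ← add_assoc, ← add_smul]
      simp
    rw [h2, smul_eq_mul, smul_eq_mul] at h1
    have h3 : 0 ≤ 1 / A * h y := mul_nonneg (by positivity) (h0 _)
    have h4 : 1 / A * h (y + A • w) ≤ 1 / L * h (y + A • w) :=
      mul_le_mul_of_nonneg_right (one_div_le_one_div_of_le hL0 hA) (h0 _)
    linarith
  have h1 := key L le_rfl x v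
  -- Starting at `x + v`, the backward step uses `L + 1` so that the far point is exactly `x - L •
  -- v`.
  have h2 := key (L + 1) (by linarith) (x + v) (-v)
  have h3 : x + v + (L + 1) • -v = x + (-L) • v := by module
  rw [h3, add_neg_cancel_right] at h2
  have h4 : 0 ≤ 1 / L * h (x + L • v) := mul_nonneg (by positivity) (h0 _)
  have h5 : 0 ≤ 1 / L * h (x + (-L) • v) := mul_nonneg (by positivity) (h0 _)
  rw [abs_le, mul_add]
  constructor <;> linarith

/-- The analogue of the lemma on the logarithmic derivative: the mean variation of `h` under a
translation by `v`. -/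
theorem IsLocMaxAffine.sphereMean_abs_shift_le (hn : 0 < n) (hh : IsLocMaxAffine h) (v : Euc n) :
    ∃ C : ℝ, 0 ≤ C ∧ ∀ L : ℝ, 1 ≤ L → ∃ ρ : ℝ, 0 < ρ ∧ ∀ r, 2 * ρ ≤ r →
      sphereMean n (fun θ => |h (r • θ + v) - h (r • θ)|) ≤
        C + 1 / L * (6 * 2 ^ (n - 1) * excess h (r + 2 * ρ)) := by
  obtain ⟨p, hp1, hp2, hp3⟩ := hh.exists_normalized hn
  refine ⟨|inner ℝ p v|, abs_nonneg _, fun L hL => ?_⟩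
  have hL0 : 0 < L := by linarith
  -- `L * ‖v‖` bounds the displacements `±L • v`; the 1 keeps the radius positive when `v = 0`.
  refine ⟨L * ‖v‖ + 1, by positivity, fun r hr => ?_⟩
  have hc := hh.continuous
  -- Nonnegativity is gained by subtracting a supporting affine function, whose variation under the
  -- shift is the constant `inner ℝ p v`.
  set g : Euc n → ℝ := fun x => h x - (h 0 + inner ℝ p x) with hg
  have hgc := hp1.continuous
  have hw : ∀ s : ℝ, |s| = L → sphereMean n (fun θ => g (r • θ + s • v)) ≤
      3 * 2 ^ (n - 1) * excess h (r + 2 * (L * ‖v‖ + 1)) := by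
    intro s hs
    rw [← hp3]
    refine sphereMean_shift_le hn hp1 hp2 (by positivity) ?_ hr
    rw [norm_smul, Real.norm_eq_abs, hs]
    linarith
  have h1 := hw L (abs_of_pos hL0)
  have h2 := hw (-L) (by rw [abs_neg, abs_of_pos hL0])
  have h3 := sphereMean_mono hn (u := fun θ => |h (r • θ + v) - h (r • θ)|)
    (v := fun θ => |inner ℝ p v| + 1 / L * (g (r • θ + L • v) + g (r • θ + (-L) • v)))
    (by fun_prop) (by fun_prop) fun θ _ => by
      have h4 := abs_sub_le_of_convexOn hp1.convexOn hp2 v (r • θ) hL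
      have h5 : h (r • θ + v) - h (r • θ) = inner ℝ p v + (g (r • θ + v) - g (r • θ)) := by
        simp only [hg, inner_add_right]
        ring
      rw [h5]
      exact (abs_add_le _ _).trans (by gcongr)
  rw [sphereMean_add (by fun_prop) (by fun_prop), sphereMean_const hn,
    sphereMean_const_mul (u := fun θ => g (r • θ + L • v) + g (r • θ + (-L) • v)),
    sphereMean_add (by fun_prop) (by fun_prop)] at h3
  refine h3.trans ?_
  gcongr
  linarith

end shift

/-! ### The exceptional set -/

theorem upperDensity_eq_zero {E : Set ℝ}
    (h : ∀ ε : ℝ, 0 < ε → ∀ᶠ r in atTop, volume (E ∩ Set.Icc 1 r) ≤ ENNReal.ofReal (ε * r)) :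
    upperDensity E = 0 := by
  refine Tendsto.limsup_eq (ENNReal.tendsto_nhds_zero.2 fun ε hε => ?_)
  obtain ⟨δ, hδ0, hδ⟩ := ENNReal.lt_iff_exists_nnreal_btwn.1 hε
  have hδ0' : (0 : ℝ) < δ := by exact_mod_cast hδ0
  filter_upwards [h δ hδ0', eventually_gt_atTop 0] with r hr hr0
  refine (ENNReal.div_le_of_le_mul ?_).trans hδ.le
  rwa [ENNReal.ofReal_mul hδ0'.le, ENNReal.ofReal_coe_nnreal] at hr

/-- A monotone sequence of sets of zero density has an eventual upper bound of zero density. -/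
theorem exists_zero_density_bound {A : ℕ → Set ℝ} (hA : Monotone A)
    (hmeas : ∀ k, MeasurableSet (A k))
    (h : ∀ k, ∀ ε : ℝ, 0 < ε → ∀ᶠ r in atTop,
      volume (A k ∩ Set.Icc 1 r) ≤ ENNReal.ofReal (ε * r)) :
    ∃ E : Set ℝ, MeasurableSet E ∧ upperDensity E = 0 ∧
      ∀ k, ∀ᶠ r in atTop, r ∈ A k → r ∈ E := by
  have h' : ∀ k : ℕ, ∃ ρ : ℝ, ∀ r, ρ ≤ r →
      volume (A k ∩ Set.Icc 1 r) ≤ ENNReal.ofReal (1 / ((k : ℝ) + 1) * r) := fun k =>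
    eventually_atTop.1 (h k (1 / ((k : ℝ) + 1)) (by positivity))
  choose ρ hρ using h'
  -- The sum dominates all of `ρ 0, …, ρ k` and is monotone in `k`; the summand `k` forces `R k →
  -- ∞`.
  set R : ℕ → ℝ := fun k => ∑ j ∈ Finset.range (k + 1), |ρ j| + k with hR
  have hRmono : Monotone R := monotone_nat_of_le_succ fun k => by
    simp only [hR, Finset.sum_range_succ _ (k + 1)]
    push_cast
    linarith [abs_nonneg (ρ (k + 1))]
  have hRk : ∀ k : ℕ, (k : ℝ) ≤ R k := fun k =>
    le_add_of_nonneg_left (Finset.sum_nonneg fun j _ => abs_nonneg _)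
  have hRρ : ∀ k, ρ k ≤ R k := fun k => by
    have := Finset.single_le_sum (f := fun j => |ρ j|) (fun j _ => abs_nonneg _)
      (Finset.self_mem_range_succ k)
    have h2 : (0 : ℝ) ≤ k := k.cast_nonneg
    have h3 := le_abs_self (ρ k)
    simp only [hR]
    linarith
  refine ⟨⋃ k, A k ∩ Set.Ici (R k), MeasurableSet.iUnion fun k =>
    (hmeas k).inter measurableSet_Ici, upperDensity_eq_zero fun ε hε => ?_, fun k => ?_⟩
  · obtain ⟨k₀, hk₀⟩ := exists_nat_one_div_lt hε
    filter_upwards [eventually_ge_atTop (R k₀), eventually_ge_atTop 0] with r hr hr0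
    -- For the last threshold `R k ≤ r`, only sets `A j` with `j ≤ k` contribute below `r`, and all
    -- of them lie in `A k`.
    set k := Nat.findGreatest (fun k => R k ≤ r) ⌊r⌋₊ with hk
    have hle : ∀ j, R j ≤ r → j ≤ k := fun j hj =>
      Nat.le_findGreatest (Nat.le_floor ((hRk j).trans hj)) hj
    have hkr : R k ≤ r :=
      Nat.findGreatest_spec (P := fun k => R k ≤ r) (Nat.le_floor ((hRk k₀).trans hr)) hr
    have hsub : (⋃ k, A k ∩ Set.Ici (R k)) ∩ Set.Icc 1 r ⊆ A k ∩ Set.Icc 1 r := by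
      rintro x ⟨hx, hxr⟩
      obtain ⟨j, hj, hjx⟩ := Set.mem_iUnion.1 hx
      exact ⟨hA (hle j (le_trans hjx hxr.2)) hj, hxr⟩
    refine (measure_mono hsub).trans ((hρ k r ((hRρ k).trans hkr)).trans
      (ENNReal.ofReal_le_ofReal (mul_le_mul_of_nonneg_right ?_ hr0)))
    refine (one_div_le_one_div_of_le (by positivity) ?_).trans hk₀.le
    have : (k₀ : ℝ) ≤ k := by exact_mod_cast hle k₀ hr
    linarith
  · filter_upwards [eventually_ge_atTop (R k)] with r hr hrA
    exact Set.mem_iUnion.2 ⟨k, hrA, hr⟩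

/-- The set where a function of subexponential growth doubles within distance `s` has density
zero. -/
theorem volume_doubling_set_le {T : ℝ → ℝ} (hT : Continuous T) (hmono : MonotoneOn T (Set.Ici 0))
    {r₀ : ℝ} (hr₀ : 1 ≤ r₀) (hT1 : ∀ r, r₀ ≤ r → 1 ≤ T r)
    (hlog : ∀ ε : ℝ, 0 < ε → ∀ᶠ r in atTop, Real.log (T r) ≤ ε * r) {s : ℝ} (hs : 0 ≤ s)
    {ε : ℝ} (hε : 0 < ε) :
    ∀ᶠ r in atTop, volume ({r | 2 * T r < T (r + s)} ∩ Set.Icc 1 r) ≤ ENNReal.ofReal (ε * r) := by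
  -- The truncation at 1 keeps `l` continuous and nonnegative even where `T` is small.
  set l : ℝ → ℝ := fun r => Real.log (max (T r) 1) with hl
  have hlc : Continuous l :=
    (hT.max continuous_const).log fun r => (lt_max_of_lt_right one_pos).ne'
  have hlm : ∀ x y, 0 ≤ x → x ≤ y → l x ≤ l y := fun x y hx hxy =>
    Real.log_le_log (lt_max_of_lt_right one_pos)
      (max_le_max_right 1 (hmono hx (hx.trans hxy) hxy))
  have hl0 : ∀ x, 0 ≤ l x := fun x => Real.log_nonneg (le_max_right _ _)
  have hlT : ∀ r, r₀ ≤ r → l r = Real.log (T r) := fun r hr => by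
    simp only [hl, max_eq_left (hT1 r hr)]
  have hlog2 : 0 < Real.log 2 := Real.log_pos one_lt_two
  -- On the doubling set `l (r + s) - l r ≥ log 2`, while the integral of this difference telescopes
  -- to at most `s * l (R + s)`; Markov's inequality concludes.
  have hmain : ∀ R, r₀ ≤ R → Real.log 2 *
      volume.real ({r | 2 * T r < T (r + s)} ∩ Set.Ioc r₀ R) ≤ s * l (R + s) := by
    intro R hR
    have hint : ∀ a b : ℝ, IntervalIntegrable l volume a b := fun a b =>
      hlc.intervalIntegrable a b
    have hc2 : Continuous fun r => l (r + s) - l r := by fun_prop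
    have hI : ∫ r in Set.Ioc r₀ R, (l (r + s) - l r) ≤ s * l (R + s) := by
      rw [← intervalIntegral.integral_of_le hR, intervalIntegral.integral_sub
        (f := fun r => l (r + s)) (Continuous.intervalIntegrable (by fun_prop) _ _) (hint _ _),
        intervalIntegral.integral_comp_add_right l s]
      have h1 := intervalIntegral.integral_add_adjacent_intervals (hint r₀ (r₀ + s))
        (hint (r₀ + s) (R + s))
      have h2 := intervalIntegral.integral_add_adjacent_intervals (hint r₀ R) (hint R (R + s))
      have h3 : 0 ≤ ∫ r in r₀..(r₀ + s), l r :=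
        intervalIntegral.integral_nonneg (by linarith) fun r _ => hl0 r
      have h4 : ∫ r in R..(R + s), l r ≤ ∫ r in R..(R + s), l (R + s) :=
        intervalIntegral.integral_mono_on (by linarith) (hint _ _) (by simp)
          fun r hr => hlm _ _ (by linarith [hr.1]) hr.2
      rw [intervalIntegral.integral_const, smul_eq_mul, add_sub_cancel_left] at h4
      linarith
    refine le_trans ?_ hI
    have hmk := mul_meas_ge_le_integral_of_nonneg (μ := volume.restrict (Set.Ioc r₀ R))
      (f := fun r => l (r + s) - l r)
      ((ae_restrict_mem measurableSet_Ioc).mono fun r hr =>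
        sub_nonneg.2 (hlm _ _ (by linarith [hr.1]) (by linarith)))
      (hc2.integrableOn_Ioc) (Real.log 2)
    refine le_trans (mul_le_mul_of_nonneg_left ?_ hlog2.le) hmk
    rw [measureReal_restrict_apply' measurableSet_Ioc]
    refine measureReal_mono ?_ ((measure_mono Set.inter_subset_right).trans_lt
      measure_Ioc_lt_top).ne
    rintro r ⟨hr, hrI⟩
    refine ⟨?_, hrI⟩
    have hr1 := hT1 r hrI.1.le
    have hr2 := hT1 (r + s) (by linarith [hrI.1])
    change Real.log 2 ≤ l (r + s) - l r
    rw [hlT r hrI.1.le, hlT (r + s) (by linarith [hrI.1]), le_sub_iff_add_le,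
      ← Real.log_mul two_ne_zero (by linarith)]
    exact Real.log_le_log (by linarith) (le_of_lt hr)
  -- Chosen so that `(s + 1) * (δ * 2R) = log 2 * (ε / 2 * R)`; using `s + 1` avoids division by
  -- zero. The other `ε / 2` absorbs `[1, r₀]`.
  set δ := ε * Real.log 2 / (4 * (s + 1)) with hδ
  have hδ0 : 0 < δ := by positivity
  filter_upwards [eventually_ge_atTop r₀, eventually_ge_atTop s,
    eventually_ge_atTop (2 * r₀ / ε),
    (tendsto_atTop_add_const_right atTop s tendsto_id).eventually (hlog δ hδ0)] with R h1 h2 h3 h4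
  have h5 : {r | 2 * T r < T (r + s)} ∩ Set.Icc 1 R ⊆
      Set.Icc 1 r₀ ∪ {r | 2 * T r < T (r + s)} ∩ Set.Ioc r₀ R := by
    rintro x ⟨hx, hx1, hxR⟩
    rcases le_or_gt x r₀ with h | h
    · exact Or.inl ⟨hx1, h⟩
    · exact Or.inr ⟨hx, h, hxR⟩
  have h6 : volume.real ({r | 2 * T r < T (r + s)} ∩ Set.Ioc r₀ R) ≤ ε / 2 * R := by
    refine le_of_mul_le_mul_left ((hmain R h1).trans ?_) hlog2
    rw [hlT _ (by linarith)]
    simp only [id] at h4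
    calc s * Real.log (T (R + s)) ≤ (s + 1) * (δ * (2 * R)) := by
          have h7 : Real.log (T (R + s)) ≤ δ * (2 * R) :=
            h4.trans (mul_le_mul_of_nonneg_left (by linarith) hδ0.le)
          have h8 : 0 ≤ δ * (2 * R) := by
            have : 0 ≤ R := by linarith
            positivity
          calc s * Real.log (T (R + s)) ≤ s * (δ * (2 * R)) := mul_le_mul_of_nonneg_left h7 hs
            _ ≤ (s + 1) * (δ * (2 * R)) := mul_le_mul_of_nonneg_right (by linarith) h8
      _ = Real.log 2 * (ε / 2 * R) := by
          rw [hδ]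
          field_simp
          ring
  have h7 : volume ({r | 2 * T r < T (r + s)} ∩ Set.Ioc r₀ R) ≤ ENNReal.ofReal (ε / 2 * R) := by
    rw [← ENNReal.ofReal_toReal (a := volume ({r | 2 * T r < T (r + s)} ∩ Set.Ioc r₀ R))
      ((measure_mono Set.inter_subset_right).trans_lt measure_Ioc_lt_top).ne]
    exact ENNReal.ofReal_le_ofReal h6
  have h8 : r₀ ≤ ε / 2 * R := by
    rw [div_le_iff₀ hε] at h3
    linarith
  calc volume ({r | 2 * T r < T (r + s)} ∩ Set.Icc 1 R)
      ≤ volume (Set.Icc 1 r₀) + volume ({r | 2 * T r < T (r + s)} ∩ Set.Ioc r₀ R) :=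
        (measure_mono h5).trans (measure_union_le _ _)
    _ ≤ ENNReal.ofReal (ε / 2 * R) + ENNReal.ofReal (ε / 2 * R) := by
        refine add_le_add ?_ h7
        rw [Real.volume_Icc]
        exact ENNReal.ofReal_le_ofReal (by linarith)
    _ = ENNReal.ofReal (ε * R) := by
        rw [← ENNReal.ofReal_add (by linarith) (by linarith)]
        congr 1
        ring

/-- One set must serve all shifts. Integer shifts give increasing doubling sets, which are merged by
the diagonal bound; a real shift is dominated by an integer one since `T` is monotone. -/
theorem exists_exceptional_set {T : ℝ → ℝ} (hT : Continuous T)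
    (hmono : MonotoneOn T (Set.Ici 0)) (hT1 : ∀ᶠ r in atTop, 1 ≤ T r)
    (hlog : ∀ ε : ℝ, 0 < ε → ∀ᶠ r in atTop, Real.log (T r) ≤ ε * r) :
    ∃ E : Set ℝ, MeasurableSet E ∧ upperDensity E = 0 ∧
      ∀ s, 0 ≤ s → ∀ᶠ r in atTop ⊓ 𝓟 Eᶜ, T (r + s) ≤ 2 * T r := by
  obtain ⟨r₁, hr₁⟩ := eventually_atTop.1 hT1
  obtain ⟨E, hE, hE0, hEA⟩ := exists_zero_density_bound
    (A := fun k : ℕ => {r | 2 * T r < T (r + k)} ∩ Set.Ici 0)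
    (fun k j hkj r hr => by
      have hkj' : (k : ℝ) ≤ j := by exact_mod_cast hkj
      have hk0 : (0 : ℝ) ≤ k := k.cast_nonneg
      have h0 : (0 : ℝ) ≤ r := hr.2
      exact ⟨lt_of_lt_of_le hr.1 (hmono (Set.mem_Ici.2 (by linarith))
        (Set.mem_Ici.2 (by linarith)) (by linarith)), hr.2⟩)
    (fun k => (measurableSet_lt (by fun_prop) (by fun_prop)).inter measurableSet_Ici)
    (fun k ε hε => (volume_doubling_set_le hT hmono (le_max_right r₁ 1)
      (fun r hr => hr₁ r ((le_max_left _ _).trans hr)) hlog k.cast_nonneg hε).mono fun r hr =>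
        (measure_mono (Set.inter_subset_inter_left _ Set.inter_subset_left)).trans hr)
  refine ⟨E, hE, hE0, fun s hs => ?_⟩
  obtain ⟨k, hk⟩ := exists_nat_ge s
  rw [eventually_inf_principal]
  filter_upwards [hEA k, eventually_ge_atTop 0] with r hr hr0 hrE
  have h1 : T (r + k) ≤ 2 * T r := by
    by_contra! hlt
    exact hrE (hr ⟨hlt, hr0⟩)
  have hk0 : (0 : ℝ) ≤ k := k.cast_nonneg
  exact (hmono (Set.mem_Ici.2 (by linarith)) (Set.mem_Ici.2 (by linarith))
    (by linarith)).trans h1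

/-! ### Polynomials in `f`, nondegeneracy and the Casorati determinant -/

section

variable {n m d : ℕ} {F : Fin (m + 1) → Euc n → ℝ}

theorem isLocMaxAffine_comp (hF : ∀ i, IsLocMaxAffine (F i)) (P : HomTropPoly m d) :
    IsLocMaxAffine (P.comp F) :=
  IsLocMaxAffine.sup' P.support_nonempty fun I _ => (IsLocMaxAffine.const (P.coeff I)).add
    (IsLocMaxAffine.sum Finset.univ fun i _ => (hF i).const_mul (I i).cast_nonneg)

theorem isLocMaxAffine_maxNorm (hF : ∀ i, IsLocMaxAffine (F i)) : IsLocMaxAffine (maxNorm F) :=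
  IsLocMaxAffine.sup' Finset.univ_nonempty fun i _ => hF i

theorem isLocMaxAffine_casorati {k : ℕ} {g : Fin k → Euc n → ℝ} (hg : ∀ j, IsLocMaxAffine (g j))
    (c : Euc n) : IsLocMaxAffine (casorati c g) :=
  IsLocMaxAffine.sup' Finset.univ_nonempty fun _ _ =>
    IsLocMaxAffine.sum Finset.univ fun j _ => (hg j).comp_add_right _

theorem le_maxNorm (i : Fin (m + 1)) (x : Euc n) : F i x ≤ maxNorm F x :=
  Finset.le_sup' (fun i => F i x) (Finset.mem_univ i)

theorem comp_le_mul_maxNorm (F : Fin (m + 1) → Euc n → ℝ) (P : HomTropPoly m d) :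
    ∃ C, ∀ x, P.comp F x ≤ d * maxNorm F x + C := by
  refine ⟨P.support.sup' P.support_nonempty P.coeff, fun x => ?_⟩
  rw [HomTropPoly.comp, HomTropPoly.eval]
  refine Finset.sup'_le _ _ fun I hI => ?_
  have h1 : ∑ i, (I i : ℝ) * F i x ≤ d * maxNorm F x := by
    rw [← P.homogeneous I hI, Nat.cast_sum, Finset.sum_mul]
    exact Finset.sum_le_sum fun i _ =>
      mul_le_mul_of_nonneg_left (le_maxNorm i x) (I i).cast_nonneg
  have h2 := Finset.le_sup' P.coeff hI
  rw [HomTropPoly.term]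
  linarith

theorem card_piAntidiag_univ (m d : ℕ) :
    (Finset.piAntidiag (Finset.univ : Finset (Fin (m + 1))) d).card = (m + d).choose d := by
  rw [← Finset.map_sym_eq_piAntidiag, Finset.card_map, Finset.sym_univ, Finset.card_univ,
    Sym.card_sym_eq_choose, Fintype.card_fin]
  congr 1
  omega

/-- `P` itself competes in the definition of `algLength`, so completeness forces its support to
contain every monomial of degree `d`. The pure powers already dominate `d * maxNorm F` up to a
constant. -/
theorem mul_maxNorm_le_comp_of_complete (P : HomTropPoly m d)
    (hP : ¬ algLength F d (P.comp F) < (m + d).choose d) :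
    ∃ C, ∀ x, d * maxNorm F x ≤ P.comp F x + C := by
  classical
  have h1 : algLength F d (P.comp F) ≤ P.support.card := Nat.sInf_le ⟨P, rfl, fun _ => rfl⟩
  have hsub : P.support ⊆ Finset.piAntidiag Finset.univ d := fun I hI =>
    Finset.mem_piAntidiag.2 ⟨P.homogeneous I hI, fun i _ => Finset.mem_univ i⟩
  have heq : P.support = Finset.piAntidiag Finset.univ d :=
    Finset.eq_of_subset_of_card_le hsub
      ((card_piAntidiag_univ m d).le.trans ((not_lt.1 hP).trans h1))
  refine ⟨Finset.univ.sup' Finset.univ_nonempty fun i => - P.coeff (Pi.single i d), fun x => ?_⟩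
  obtain ⟨i, -, hi⟩ := Finset.exists_mem_eq_sup' Finset.univ_nonempty (fun i => F i x)
  have hmem : Pi.single i d ∈ P.support := by
    rw [heq]
    exact Finset.mem_piAntidiag.2 ⟨by simp, fun i _ => Finset.mem_univ i⟩
  have h2 : P.term (Pi.single i d) (fun i => F i x) ≤ P.comp F x :=
    Finset.le_sup' (fun I => P.term I (fun i => F i x)) hmem
  have h3 : P.term (Pi.single i d) (fun i => F i x) = P.coeff (Pi.single i d) + d * F i x := by
    rw [HomTropPoly.term, Finset.sum_eq_single i]
    · simp
    · intro j _ hj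
      simp [Pi.single_eq_of_ne hj]
    · simp
  have h4 := Finset.le_sup' (fun i => - P.coeff (Pi.single i d)) (Finset.mem_univ i)
  have h5 : maxNorm F x = F i x := hi
  rw [h5]
  linarith

/-- A Liouville argument: a subgradient `w ≠ v` would push `h` above the affine bound far out in the
direction `w - v`. So `v` is a subgradient at every point. -/
theorem IsLocMaxAffine.eq_affine_of_le {h : Euc n → ℝ} (hh : IsLocMaxAffine h) {a : ℝ} {v : Euc n}
    (hle : ∀ x, h x ≤ a + inner ℝ v x) : ∀ x, h x = h 0 + inner ℝ v x := by
  have key : ∀ x₀ x, h x₀ + inner ℝ v (x - x₀) ≤ h x := by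
    intro x₀
    obtain ⟨w, hw⟩ := hh.exists_affine_le x₀
    have hwv : w = v := by
      by_contra hne
      have hpos : 0 < ‖w - v‖ ^ 2 := by
        have := norm_pos_iff.2 (sub_ne_zero.2 hne)
        positivity
      set t := (a + inner ℝ v x₀ - h x₀ + 1) / ‖w - v‖ ^ 2 with ht
      have h1 := (hw (x₀ + t • (w - v))).trans (hle _)
      have h2 : t * ‖w - v‖ ^ 2 = a + inner ℝ v x₀ - h x₀ + 1 := div_mul_cancel₀ _ hpos.ne'
      have h3 : ‖w - v‖ ^ 2 = inner ℝ w (w - v) - inner ℝ v (w - v) := by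
        rw [← inner_sub_left, real_inner_self_eq_norm_sq]
      rw [h3, mul_sub] at h2
      rw [add_sub_cancel_left, inner_add_right, inner_smul_right, inner_smul_right] at h1
      linarith
    rwa [hwv] at hw
  intro x
  have h1 := key 0 x
  have h2 := key x 0
  rw [sub_zero] at h1
  rw [zero_sub, inner_neg_right] at h2
  linarith

/-- The characteristic function of a nondegenerate map does not vanish identically. -/
theorem exists_excess_maxNorm_pos (hn : 0 < n) (hm : 0 < m) {f : Euc n → TropicalProjectiveSpace m}
    (hf : ∀ x, f x = Submodule.Quotient.mk (fun i => F i x)) (hF : ∀ i, IsLocMaxAffine (F i))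
    (hnd : IsAlgebraicallyNondegenerate f) : ∃ r, 0 ≤ r ∧ 0 < excess (maxNorm F) r := by
  classical
  by_contra! hcon
  have hM := isLocMaxAffine_maxNorm hF
  obtain ⟨v, hv⟩ := hM.eq_affine_of_excess_eq_zero hn fun r hr =>
    le_antisymm (hcon r hr) (hM.excess_nonneg hn r)
  have hFi : ∀ i x, F i x = F i 0 + inner ℝ v x := fun i =>
    (hF i).eq_affine_of_le fun x => (le_maxNorm i x).trans (hv x).le
  let I : Fin (m + 1) → Fin (m + 1) → ℕ := fun i => Pi.single i 1
  have hI : Function.Injective I := fun i j hij => by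
    by_contra hne
    have := congrFun hij i
    simp [I, Pi.single_eq_of_ne hne] at this
  -- If `T_f` vanished, all `F i` would be affine with the same slope. With coefficients `-F i 0`
  -- the monomials of this linear form coincide everywhere, so the image of `f` lies in its
  -- hypersurface.
  let P : HomTropPoly m 1 :=
    { support := Finset.univ.image I
      support_nonempty := Finset.univ_nonempty.image I
      homogeneous := fun K hK => by
        obtain ⟨i, -, rfl⟩ := Finset.mem_image.1 hK
        simp [I]
      coeff := fun K => - ∑ i, (K i : ℝ) * F i 0 }
  have hterm : ∀ x, ∀ K ∈ P.support, P.term K (fun i => F i x) = inner ℝ v x := by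
    intro x K hK
    have h1 : ∑ i, (K i : ℝ) = 1 := by exact_mod_cast P.homogeneous K hK
    rw [HomTropPoly.term]
    change - ∑ i, (K i : ℝ) * F i 0 + _ = _
    rw [neg_add_eq_sub, ← Finset.sum_sub_distrib]
    calc ∑ i, ((K i : ℝ) * F i x - K i * F i 0) = ∑ i, (K i : ℝ) * inner ℝ v x :=
          Finset.sum_congr rfl fun i _ => by rw [hFi i x]; ring
      _ = inner ℝ v x := by rw [← Finset.sum_mul, h1, one_mul]
  have heval : ∀ x, P.eval (fun i => F i x) = inner ℝ v x := by
    intro x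
    rw [HomTropPoly.eval, Finset.sup'_congr _ rfl (hterm x), Finset.sup'_const]
  refine hnd 1 P one_pos ?_
  rintro _ ⟨x, rfl⟩
  have hmem : ∀ i, I i ∈ P.support := fun i => Finset.mem_image_of_mem I (Finset.mem_univ i)
  refine ⟨fun i => F i x, (hf x).symm, I 0, hmem 0, I (Fin.last m), hmem _, ?_, ?_, ?_⟩
  · intro h
    have := hI h
    rw [Fin.ext_iff] at this
    simp at this
    omega
  · rw [hterm x _ (hmem _), heval]
  · rw [hterm x _ (hmem _), heval]

theorem tendsto_excess_atTop (hn : 0 < n) {g : Euc n → ℝ} (hg : IsLocMaxAffine g)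
    (hpos : ∃ r, 0 ≤ r ∧ 0 < excess g r) : Tendsto (excess g) atTop atTop := by
  obtain ⟨r₀, hr₀, hT⟩ := hpos
  have hr₀' : 0 < r₀ := by
    rcases hr₀.eq_or_lt with rfl | h
    · rw [IsLocMaxAffine.excess_zero hn] at hT
      exact absurd hT (lt_irrefl 0)
    · exact h
  refine tendsto_atTop_mono' atTop ?_ (tendsto_id.const_mul_atTop (div_pos hT hr₀'))
  filter_upwards [eventually_ge_atTop r₀] with r hr
  have := hg.mul_excess_le hn hr₀ hr
  rw [div_mul_eq_mul_div, div_le_iff₀ hr₀', id]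
  linarith

theorem eventually_log_le_of_subnormalGrowth {T : ℝ → ℝ} (hT : SubnormalGrowth T) {ε : ℝ}
    (hε : 0 < ε) : ∀ᶠ r in atTop, Real.log (T r) ≤ ε * r := by
  have h1 : limsup (fun r : ℝ => ((Real.log (T r) / r : ℝ) : EReal)) atTop < (ε : EReal) := by
    rw [hT]
    exact_mod_cast hε
  filter_upwards [eventually_lt_of_limsup_lt h1, eventually_gt_atTop 0] with r hr hr0
  have hr' : Real.log (T r) / r < ε := by exact_mod_cast hr
  exact ((div_lt_iff₀ hr0).1 hr').le

/-- Translations change a function of growth at most `T` little in the mean. -/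
theorem isLittleO_sphereMean_abs_shift (hn : 0 < n) {h : Euc n → ℝ} (hh : IsLocMaxAffine h)
    (v : Euc n) {T : ℝ → ℝ} {l : Filter ℝ} (hl : l ≤ atTop) (hT : Tendsto T l atTop)
    (hdouble : ∀ s, 0 ≤ s → ∀ᶠ r in l, T (r + s) ≤ 2 * T r) {A B : ℝ} (hA : 0 ≤ A) (hB : 0 ≤ B)
    (hAB : ∀ r, excess h r ≤ A * T r + B) :
    (fun r => sphereMean n (fun θ => |h (r • θ + v) - h (r • θ)|)) =o[l] T := by
  obtain ⟨C, hC, hL⟩ := hh.sphereMean_abs_shift_le hn v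
  refine isLittleO_iff.2 fun ε hε => ?_
  set K : ℝ := 6 * 2 ^ (n - 1) with hK
  have hK0 : 0 < K := by positivity
  -- This makes `1 / L * (2 * K * A) ≤ ε / 2`; the other half of `ε` absorbs the constants, as `T`
  -- tends to infinity.
  set L : ℝ := 1 + 4 * K * A / ε with hLdef
  have hL1 : 1 ≤ L := by
    have : 0 ≤ 4 * K * A / ε := by positivity
    linarith
  obtain ⟨ρ, hρ, hmain⟩ := hL L hL1
  filter_upwards [hl (eventually_ge_atTop (2 * ρ)), hdouble (2 * ρ) (by linarith),
    hT.eventually_ge_atTop 0, hT.eventually_ge_atTop (2 * (C + K * B) / ε)] with r h1 h2 h3 h4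
  have h0 : 0 ≤ sphereMean n (fun θ => |h (r • θ + v) - h (r • θ)|) :=
    sphereMean_nonneg hn fun _ => abs_nonneg _
  rw [Real.norm_of_nonneg h0, Real.norm_of_nonneg h3]
  have hL0 : 0 < L := by linarith
  have h5 : 1 / L * (2 * K * A) ≤ ε / 2 := by
    rw [one_div_mul_eq_div, div_le_iff₀ hL0, hLdef]
    have : ε / 2 * (1 + 4 * K * A / ε) = ε / 2 + 2 * K * A := by field_simp; ring
    linarith
  have h6 : 1 / L * (K * B) ≤ K * B :=
    mul_le_of_le_one_left (by positivity) ((div_le_one hL0).2 hL1)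
  have h7 : C + K * B ≤ ε / 2 * T r := by
    rw [div_le_iff₀ hε] at h4
    linarith
  calc sphereMean n (fun θ => |h (r • θ + v) - h (r • θ)|)
      ≤ C + 1 / L * (K * excess h (r + 2 * ρ)) := hmain r h1
    _ ≤ C + 1 / L * (K * (A * (2 * T r) + B)) := by
        have := (hAB (r + 2 * ρ)).trans (add_le_add_left (mul_le_mul_of_nonneg_left h2 hA) B)
        gcongr
    _ = C + 1 / L * (K * B) + 1 / L * (2 * K * A) * T r := by ring
    _ ≤ C + K * B + ε / 2 * T r := by gcongr
    _ ≤ ε * T r := by linarith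

/-- At a maximizing permutation the difference is a sum of translation differences of the `g j`;
summing over all shifts `i` removes the dependence on that permutation. -/
theorem abs_casorati_sub_sum_le {k : ℕ} (c : Euc n) (g : Fin k → Euc n → ℝ) (x : Euc n) :
    |casorati c g x - ∑ j, g j x| ≤
      ∑ j, ∑ i : Fin k, |g j (x + ((i : ℕ) : ℝ) • c) - g j x| := by
  obtain ⟨π, -, hπ⟩ := Finset.exists_mem_eq_sup' (Finset.univ_nonempty)
    (fun π : Equiv.Perm (Fin k) => ∑ j, g j (x + ((π j : ℕ) : ℝ) • c))
  have h1 : casorati c g x = ∑ j, g j (x + ((π j : ℕ) : ℝ) • c) := hπ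
  rw [h1, ← Finset.sum_sub_distrib]
  refine (Finset.abs_sum_le_sum_abs _ _).trans (Finset.sum_le_sum fun j _ => ?_)
  exact Finset.single_le_sum (f := fun i : Fin k => |g j (x + ((i : ℕ) : ℝ) • c) - g j x|)
    (fun _ _ => abs_nonneg _) (Finset.mem_univ (π j))

theorem isLittleO_excess_casorati (hn : 0 < n) {k : ℕ} (c : Euc n) {g : Fin k → Euc n → ℝ}
    (hg : ∀ j, IsLocMaxAffine (g j)) {T : ℝ → ℝ} {l : Filter ℝ} (hl : l ≤ atTop)
    (hT : Tendsto T l atTop) (hdouble : ∀ s, 0 ≤ s → ∀ᶠ r in l, T (r + s) ≤ 2 * T r)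
    {A : ℝ} (hA : 0 ≤ A) (hgT : ∀ j, ∃ B, ∀ r, excess (g j) r ≤ A * T r + B) :
    (fun r => (∑ j, excess (g j) r) - excess (casorati c g) r) =o[l] T := by
  have hconst : ∀ a : ℝ, (fun _ : ℝ => a) =o[l] T := fun a =>
    isLittleO_const_left.2 (Or.inr (tendsto_norm_atTop_atTop.comp hT))
  have hCc := (isLocMaxAffine_casorati hg c).continuous
  have hgc := fun j => (hg j).continuous
  have hsum : (fun r => ∑ j, ∑ i : Fin k,
      sphereMean n (fun θ => |g j (r • θ + ((i : ℕ) : ℝ) • c) - g j (r • θ)|)) =o[l] T := by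
    refine IsLittleO.fun_sum fun j _ => IsLittleO.fun_sum (s := Finset.univ)
      (A := fun (i : Fin k) r =>
        sphereMean n (fun θ => |g j (r • θ + ((i : ℕ) : ℝ) • c) - g j (r • θ)|)) fun i _ => ?_
    obtain ⟨B, hB⟩ := hgT j
    exact isLittleO_sphereMean_abs_shift hn (hg j) _ hl hT hdouble hA (abs_nonneg B)
      fun r => (hB r).trans (add_le_add_right (le_abs_self B) _)
  refine IsBigO.trans_isLittleO (IsBigO.of_bound' (Eventually.of_forall fun r => ?_))
    (hsum.add (hconst (|casorati c g 0 - ∑ j, g j 0|)))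
  rw [← excess_sum Finset.univ (fun j _ => hgc j), ← excess_sub (by fun_prop) hCc, excess]
  rw [Real.norm_eq_abs, Real.norm_eq_abs]
  refine le_trans ?_ (le_abs_self _)
  rw [abs_sub_comm (casorati c g 0)]
  refine (abs_sub _ _).trans (add_le_add_left ?_ _)
  refine (abs_sphereMean_le hn).trans ?_
  have h1 := sphereMean_mono hn (u := fun θ => |∑ j, g j (r • θ) - casorati c g (r • θ)|)
    (v := fun θ => ∑ j, ∑ i : Fin k, |g j (r • θ + ((i : ℕ) : ℝ) • c) - g j (r • θ)|)
    (by fun_prop) (by fun_prop) fun θ _ => by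
      rw [abs_sub_comm]
      exact abs_casorati_sub_sum_le c g (r • θ)
  refine h1.trans (le_of_eq ?_)
  rw [sphereMean_sum Finset.univ (U := fun j θ =>
    ∑ i : Fin k, |g j (r • θ + ((i : ℕ) : ℝ) • c) - g j (r • θ)|) fun j _ => by fun_prop]
  exact Finset.sum_congr rfl fun j _ => sphereMean_sum Finset.univ (U := fun i θ =>
    |g j (r • θ + (((i : Fin k) : ℕ) : ℝ) • c) - g j (r • θ)|) fun i _ => by fun_prop

end

end TropicalNevanlinna

/-! ### The Second Main Theorem -/

theorem mainTheorem1 (n m q : ℕ) (hn : 0 < n) (hm : 0 < m)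
    (f : Euc n → TropicalProjectiveSpace m)
    (F : Fin (m + 1) → Euc n → ℝ) (hF : IsReducedRepresentation f F)
    (hnd : IsAlgebraicallyNondegenerate f)
    (hgrowth : SubnormalGrowth (cartanT F))
    (deg : Fin q → ℕ) (hdeg : ∀ j, 0 < deg j)
    (P : ∀ j, HomTropPoly m (deg j))
    (d M : ℕ) (hd : d = Finset.univ.lcm deg) (hM : M = (m + d).choose d - 1)
    (hMq : M + 1 ≤ q)
    (lam : ℕ) (hlam : lam = ddg F P (Finset.univ.filter (fun j : Fin q => M + 1 ≤ (j : ℕ))))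
    (c : Euc n) (hc : c ≠ 0) :
    ∃ E : Set ℝ, MeasurableSet E ∧ upperDensity E = 0 ∧
      ∃ e₁ e₂ e₃ : ℝ → ℝ,
        e₁ =o[atTop ⊓ 𝓟 Eᶜ] cartanT F ∧
        e₂ =o[atTop ⊓ 𝓟 Eᶜ] cartanT F ∧
        e₃ =o[atTop ⊓ 𝓟 Eᶜ] cartanT F ∧
        ∀ᶠ r in atTop ⊓ 𝓟 Eᶜ,
          ((q : ℝ) - M - 1 - lam) * cartanT F r
            ≤ (∑ j, (1 / (deg j : ℝ)) * countingRoots r ((P j).comp F)) + e₁ r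
              - (1 / (d : ℝ)) * countingRoots r
                  (casorati c (fun (j : Fin (M + 1)) (x : Euc n) =>
                    ((d : ℝ) / (deg (Fin.castLE hMq j) : ℝ)) *
                      (P (Fin.castLE hMq j)).comp F x)) ∧
          (∑ j, (1 / (deg j : ℝ)) * countingRoots r ((P j).comp F)) + e₁ r
              - (1 / (d : ℝ)) * countingRoots r
                  (casorati c (fun (j : Fin (M + 1)) (x : Euc n) =>
                    ((d : ℝ) / (deg (Fin.castLE hMq j) : ℝ)) *
                      (P (Fin.castLE hMq j)).comp F x))
            ≤ (∑ j ∈ Finset.univ.filter (fun j : Fin q => M + 1 ≤ (j : ℕ)),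
                (1 / (deg j : ℝ)) * countingRoots r ((P j).comp F)) + e₂ r ∧
          (∑ j ∈ Finset.univ.filter (fun j : Fin q => M + 1 ≤ (j : ℕ)),
                (1 / (deg j : ℝ)) * countingRoots r ((P j).comp F)) + e₂ r
            ≤ ((q : ℝ) - M - 1) * cartanT F r + e₃ r := by
  classical
  have hFe : ∀ i, IsLocMaxAffine (F i) := fun i => (hF.entire i).isLocMaxAffine
  have hMn := isLocMaxAffine_maxNorm hFe
  have hPl : ∀ j, IsLocMaxAffine ((P j).comp F) := fun j => isLocMaxAffine_comp hFe (P j)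
  have hdegR : ∀ j, (0 : ℝ) < deg j := fun j => by exact_mod_cast hdeg j
  have hd0 : (0 : ℝ) < d := by
    have : d ≠ 0 := by
      rw [hd, Ne, Finset.lcm_eq_zero_iff]
      rintro ⟨j, -, hj⟩
      exact (hdeg j).ne' hj
    exact_mod_cast Nat.pos_of_ne_zero this
  have hT : Tendsto (cartanT F) atTop atTop := tendsto_excess_atTop hn hMn
    (exists_excess_maxNorm_pos hn hm hF.represents hFe hnd)
  obtain ⟨E, hE, hE0, hdouble⟩ := exists_exceptional_set (T := cartanT F)
    (hMn.continuous_excess hn) (fun r hr s _ hrs => hMn.excess_mono hn hr hrs)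
    (hT.eventually_ge_atTop 1) (fun ε hε => eventually_log_le_of_subnormalGrowth hgrowth hε)
  refine ⟨E, hE, hE0, ?_⟩
  have hl : atTop ⊓ 𝓟 Eᶜ ≤ (atTop : Filter ℝ) := inf_le_left
  have hTl := hT.mono_left hl
  have hconst : ∀ a : ℝ, (fun _ : ℝ => a) =o[atTop ⊓ 𝓟 Eᶜ] cartanT F := fun a =>
    isLittleO_const_left.2 (Or.inr (tendsto_norm_atTop_atTop.comp hTl))
  have hupper : ∀ j, ∃ B, ∀ r, 1 / (deg j : ℝ) * excess ((P j).comp F) r ≤ cartanT F r + B :=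
    fun j => by
    obtain ⟨C, hC⟩ := comp_le_mul_maxNorm F (P j)
    have h1 := excess_mono_of_le hn (hPl j).continuous (hMn.continuous.const_mul _) hC
    refine ⟨1 / (deg j : ℝ) * (deg j * maxNorm F 0 + C - (P j).comp F 0), fun r => ?_⟩
    have h2 := mul_le_mul_of_nonneg_left (h1 r) (one_div_pos.2 (hdegR j)).le
    rw [excess_const_mul, mul_add, ← mul_assoc, one_div_mul_cancel (hdegR j).ne', one_mul] at h2
    exact h2
  have hlower : ∀ j, ¬ algLength F (deg j) ((P j).comp F) < (m + deg j).choose (deg j) →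
      ∃ B, ∀ r, cartanT F r - B ≤ 1 / (deg j : ℝ) * excess ((P j).comp F) r := fun j hj => by
    obtain ⟨C, hC⟩ := mul_maxNorm_le_comp_of_complete (P j) hj
    have h1 := excess_mono_of_le hn (hMn.continuous.const_mul (deg j : ℝ)) (hPl j).continuous hC
    refine ⟨1 / (deg j : ℝ) * ((P j).comp F 0 + C - deg j * maxNorm F 0), fun r => ?_⟩
    have h2 := mul_le_mul_of_nonneg_left (h1 r) (one_div_pos.2 (hdegR j)).le
    rw [excess_const_mul, mul_add, ← mul_assoc, one_div_mul_cancel (hdegR j).ne', one_mul] at h2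
    exact sub_le_iff_le_add.2 h2
  choose B hB using hupper
  choose! B' hB' using hlower
  set S : Finset (Fin q) := Finset.univ.filter (fun j : Fin q => M + 1 ≤ (j : ℕ)) with hS
  set N : Fin q → ℝ → ℝ := fun j r => 1 / (deg j : ℝ) * excess ((P j).comp F) r with hN
  have hN0 : ∀ j r, 0 ≤ N j r := fun j r =>
    mul_nonneg (one_div_pos.2 (hdegR j)).le ((hPl j).excess_nonneg hn r)
  set g : Fin (M + 1) → Euc n → ℝ := fun j x =>
    ((d : ℝ) / (deg (Fin.castLE hMq j) : ℝ)) * (P (Fin.castLE hMq j)).comp F x with hg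
  have hgl : ∀ j, IsLocMaxAffine (g j) := fun j =>
    (hPl _).const_mul (div_pos hd0 (hdegR _)).le
  have hgN : ∀ j r, excess (g j) r = d * N (Fin.castLE hMq j) r := fun j r => by
    rw [hg, excess_const_mul]
    simp only [hN]
    ring
  have hcas := isLittleO_excess_casorati hn c hgl hl hTl hdouble hd0.le fun j =>
    ⟨d * B (Fin.castLE hMq j), fun r => by
      rw [hgN, ← mul_add]
      exact mul_le_mul_of_nonneg_left (hB _ r) hd0.le⟩
  have himg : Finset.univ.filter (fun j : Fin q => ¬ M + 1 ≤ (j : ℕ)) =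
      Finset.univ.map (Fin.castLEEmb hMq) := by
    ext j
    simp only [Finset.mem_filter, Finset.mem_univ, true_and, Finset.mem_map]
    constructor
    · intro hj
      exact ⟨⟨j, not_le.1 hj⟩, rfl⟩
    · rintro ⟨i, rfl⟩
      exact not_le.2 i.2
  have hnotS : ∀ r, ∑ j ∈ Finset.univ.filter (fun j : Fin q => ¬ M + 1 ≤ (j : ℕ)), N j r =
      ∑ i : Fin (M + 1), N (Fin.castLE hMq i) r := fun r => by
    rw [himg, Finset.sum_map]
    rfl
  have hsplit : ∀ r, ∑ j, N j r = ∑ j ∈ S, N j r + ∑ i : Fin (M + 1), N (Fin.castLE hMq i) r :=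
    fun r => by rw [← hnotS, Finset.sum_filter_add_sum_filter_not]
  have hcardS : (S.card : ℝ) = q - M - 1 := by
    have h2 := Finset.card_filter_add_card_filter_not (s := (Finset.univ : Finset (Fin q)))
      (fun j : Fin q => M + 1 ≤ (j : ℕ))
    rw [himg, Finset.card_map, Finset.card_univ, Finset.card_univ, Fintype.card_fin,
      Fintype.card_fin] at h2
    have h3 : (S.card : ℝ) + (M + 1) = q := by exact_mod_cast h2
    linarith
  have hupS : ∀ r, ∑ j ∈ S, N j r ≤ ((q : ℝ) - M - 1) * cartanT F r + ∑ j ∈ S, B j := fun r => by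
    rw [← hcardS, ← nsmul_eq_mul, ← Finset.sum_const, ← Finset.sum_add_distrib]
    exact Finset.sum_le_sum fun j _ => hB j r
  -- A complete index contributes at least `T_f - O(1)`. An incomplete one is only bounded below by
  -- 0, so its `T_f` is given up through `lam`.
  have hloS : ∀ r, ((q : ℝ) - M - 1 - lam) * cartanT F r ≤
      ∑ j ∈ S, N j r + ∑ j ∈ S, |B' j| := fun r => by
    have hlam' : (lam : ℝ) = ∑ j ∈ S,
        if algLength F (deg j) ((P j).comp F) < (m + deg j).choose (deg j) then (1 : ℝ) else 0 := by
      rw [Finset.sum_boole, hlam]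
      rfl
    rw [hlam', ← hcardS, ← nsmul_one, ← Finset.sum_const, ← Finset.sum_sub_distrib,
      Finset.sum_mul, ← Finset.sum_add_distrib]
    refine Finset.sum_le_sum fun j _ => ?_
    split_ifs with hj
    · have := hN0 j r
      have := abs_nonneg (B' j)
      linarith
    · have := hB' j hj r
      have := le_abs_self (B' j)
      simp only [hN]
      linarith
  set D : ℝ → ℝ := fun r => 1 / (d : ℝ) * ((∑ j, excess (g j) r) - excess (casorati c g) r)
    with hD
  -- `D` is the mean discrepancy between the Casorati determinant and the sum of its entries. With
  -- `-D` in `e₁`, the first `M + 1` counting functions cancel against the Casorati term, and the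
  -- second inequality becomes an equality.
  refine ⟨fun r => ∑ j ∈ S, |B' j| - D r, fun _ => ∑ j ∈ S, |B' j|,
    fun _ => ∑ j ∈ S, |B' j| + ∑ j ∈ S, B j, (hconst _).sub (hcas.const_mul_left _), hconst _,
    hconst _, ?_⟩
  filter_upwards [hl (eventually_ge_atTop 0)] with r hr
  have hcN : ∀ j, 1 / (deg j : ℝ) * countingRoots r ((P j).comp F) = N j r := fun j => by
    rw [(hPl j).countingRoots_eq hn hr]
  have hDr : D r = ∑ i : Fin (M + 1), N (Fin.castLE hMq i) r -
      1 / (d : ℝ) * excess (casorati c g) r := by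
    simp only [hD, hgN]
    rw [← Finset.mul_sum, mul_sub, ← mul_assoc, one_div_mul_cancel hd0.ne', one_mul]
  rw [(isLocMaxAffine_casorati hgl c).countingRoots_eq hn hr]
  simp only [hcN]
  have h1 := hsplit r
  have h2 := hloS r
  have h3 := hupS r
  refine ⟨?_, ?_, ?_⟩ <;> linarith
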